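/- Let $\mathcal X=\{1,\dots,K\}$ and let $\mathcal X^*$ be the set of finite words over $\mathcal X$. For a finite set $\mathcal F\subset\mathcal X^*$ of forbidden words, the finite-type constraint defined by $\mathcal F$ is the set $\mathcal S$ of all words in $\mathcal X^*$ containing no element of $\mathcal F$ as a contiguous subword. The length of $\mathcal F$ is the length of its longest word, and the topological order $m$ of $\mathcal S$ is the smallest length of a finite $\mathcal F$ defining $\mathcal S$, minus $1$ (with $m=0$ if $\mathcal S=\mathcal X^*$). $\mathcal S$ is irreducible if for all $u,v\in\mathcal S$ there is $w\in\mathcal S$ with $uwv\in\mathcal S$. A stationary $\mathcal X$-valued process $X=(X_n)_{n\in\mathbb Z}$ is supported on $\mathcal S$ if $\mathcal A(X)\subseteq\mathcal S$, where $\mathcal A(X)$ is the set of words occurring in $X$ with positive probability. For $\varepsilon\in[0,1]$ let $(E_n)_{n\in\mathbb Z}$ be i.i.d. $\{0,1\}$-valued, independent of $X$, with $P(E_n=0)=\varepsilon$, and let $Y_n=X_nE_n$ be the output of the erasure channel. Let $I(X;Y)=\lim_{n\to\infty}\frac1n I(X_0^{n-1};Y_0^{n-1})$ be the mutual information rate and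 $H(X)=\lim_{n\to\infty}\frac1nH(X_0^{n-1})$ the entropy rate. Put $$C(\mathcal S,\varepsilon)=\sup_X I(X;Y),\qquad C^{(n)}(\mathcal S,\varepsilon)=\sup_{X\ n\text{-th order Markov}} I(X;Y),$$ the suprema being over all stationary processes, respectively all stationary $n$-th order Markov chains, supported on $\mathcal S$. Theorem. Let $\mathcal S$ be an irreducible finite-type constraint of topological order $m$ that contains a non-empty word. There is a unique (in law) stationary $m$-th order Markov chain $\hat X$ with $\mathcal A(\hat X)=\mathcal S$ and $H(\hat X)=\max_{\mathcal A(X)\subseteq\mathcal S}H(X)$, the maximum being over all stationary processes supported on $\mathcal S$, and, as $\varepsilon\to0^+$, $$C(\mathcal S,\varepsilon)=C(\mathcal S,0)-\Big\{(m+1)H(\hat X_0\mid\hat X_{-m}^{-1})-\sum_{i=1}^{m}H(\hat X_0\mid\hat X_{-i+1}^{-1},\hat X_{-i-m}^{-i-1})\Big\}\varepsilon+O(\varepsilon^2).$$ Moreover, for every $n\ge m$, $$C^{(n)}(\mathcal S,\varepsilon)=C(\mathcal S,0)-\Big\{(m+1)H(\hat X_0\mid\hat X_{-m}^{-1})-\sum_{i=1}^{m}H(\hat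 X_0\mid\hat X_{-i+1}^{-1},\hat X_{-i-m}^{-i-1})\Big\}\varepsilon+O(\varepsilon^2).$$ -/

import Mathlib

open Filter MeasureTheory ProbabilityTheory
open scoped Topology unitInterval

noncomputable section

namespace ErasureChannel

/-! ### Shannon information of finitely-valued random variables (natural logarithm) -/

section Information

variable {Ω α β : Type*} [MeasurableSpace Ω]

/-- The Shannon entropy `H(A) = -∑ p(a) log p(a)`. -/
def entropy [Fintype α] (μ : Measure Ω) (A : Ω → α) : ℝ :=
  ∑ a, Real.negMulLog (μ.real (A ⁻¹' {a}))

/-- The conditional entropy `H(A | B) = -∑ p(a, b) log p(a | b)`. -/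
def condEntropy [Fintype α] [Fintype β] (μ : Measure Ω) (A : Ω → α) (B : Ω → β) : ℝ :=
  -∑ a, ∑ b, μ.real (A ⁻¹' {a} ∩ B ⁻¹' {b}) *
    Real.log (μ.real (A ⁻¹' {a} ∩ B ⁻¹' {b}) / μ.real (B ⁻¹' {b}))

/-- The mutual information `I(A; B) = ∑ p(a, b) log (p(a, b) / (p(a) p(b)))`. -/
def mutualInfo [Fintype α] [Fintype β] (μ : Measure Ω) (A : Ω → α) (B : Ω → β) : ℝ :=
  ∑ a, ∑ b, μ.real (A ⁻¹' {a} ∩ B ⁻¹' {b}) *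
    Real.log (μ.real (A ⁻¹' {a} ∩ B ⁻¹' {b}) /
      (μ.real (A ⁻¹' {a}) * μ.real (B ⁻¹' {b})))

end Information

/-! ### Finite-type constraints over the alphabet `Fin K` -/

variable {K : ℕ}

/-- All finite words that contain no element of `F` as a contiguous subword. -/
def constraint (F : Finset (List (Fin K))) : Set (List (Fin K)) :=
  {w | ∀ f ∈ F, ¬ f <:+: w}

/-- `S` is a finite-type constraint. -/
def IsFiniteType (S : Set (List (Fin K))) : Prop :=
  ∃ F : Finset (List (Fin K)), S = constraint F

/-- The topological order: the least possible length (maximal word length) of a finite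
forbidden set defining `S`, minus one. The subtraction is truncated only for the unconstrained
`S`, whose forbidden set is empty; its order is `0`. -/
def topologicalOrder (S : Set (List (Fin K))) : ℕ :=
  sInf {L | ∃ F : Finset (List (Fin K)), S = constraint F ∧ F.sup List.length = L} - 1

/-- Any two words of `S` can be joined, inside `S`, by a word of `S`. -/
def IsIrreducibleConstraint (S : Set (List (Fin K))) : Prop :=
  ∀ u ∈ S, ∀ v ∈ S, ∃ w ∈ S, u ++ w ++ v ∈ S

/-! ### Stationary processes, given by their laws on two-sided sequences -/

/-- The left shift on two-sided sequences. -/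
def shift (x : ℤ → Fin K) : ℤ → Fin K := fun n => x (n + 1)

/-- `μ` is the law of a stationary process with values in `Fin K`. -/
structure IsStationaryLaw (μ : Measure (ℤ → Fin K)) : Prop where
  isProbabilityMeasure : IsProbabilityMeasure μ
  measurePreserving : MeasurePreserving shift μ μ

/-- The word `x_i x_{i+1} ⋯ x_{i+l-1}`. -/
def wordAt (x : ℤ → Fin K) (i : ℤ) (l : ℕ) : List (Fin K) :=
  List.ofFn fun k : Fin l => x (i + (k : ℤ))

/-- The set of all words that occur with positive probability. -/
def allowedWords (μ : Measure (ℤ → Fin K)) : Set (List (Fin K)) :=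
  {w | ∃ i : ℤ, 0 < μ {x | wordAt x i w.length = w}}

/-- The event that the process agrees with `z` at all times in `s`. -/
def agreeOn (s : Set ℤ) (z : ℤ → Fin K) : Set (ℤ → Fin K) :=
  {x | ∀ i ∈ s, x i = z i}

/-- The `n`-th order Markov property: given any longer past (of positive probability), the
conditional distribution of the present depends only on the last `n` symbols. For `n = 0` this
is independence of the present from the past. -/
def IsMarkovOfOrder (n : ℕ) (μ : Measure (ℤ → Fin K)) : Prop :=
  ∀ (t : ℤ) (k : ℕ) (z : ℤ → Fin K), n ≤ k → μ (agreeOn (Set.Ico (t - k) t) z) ≠ 0 →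
    μ[agreeOn {t} z | agreeOn (Set.Ico (t - k) t) z] =
      μ[agreeOn {t} z | agreeOn (Set.Ico (t - n) t) z]

/-- The entropy rate `H(X) = lim H(X_0, …, X_{n-1}) / n`. -/
def entropyRate (μ : Measure (ℤ → Fin K)) : ℝ :=
  limUnder atTop fun n : ℕ => entropy μ (fun x (k : Fin n) => x (k : ℤ)) / (n : ℝ)

/-- The conditional entropy `H(X_0 | X_D)` for a finite set `D` of times. -/
def condEntropyZero (μ : Measure (ℤ → Fin K)) (D : Finset ℤ) : ℝ :=
  condEntropy μ (fun x => x 0) (fun x (d : D) => x (d : ℤ))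

/-- `μ` is the law of a maxentropic chain of order `m` for `S`: a stationary `m`-th order Markov
chain whose set of allowed words is `S` and whose entropy rate is the maximum over all stationary
processes supported on `S`. -/
structure IsMaxentropic (S : Set (List (Fin K))) (m : ℕ) (μ : Measure (ℤ → Fin K)) : Prop where
  stationary : IsStationaryLaw μ
  markov : IsMarkovOfOrder m μ
  allowedWords_eq : allowedWords μ = S
  entropyRate_le : ∀ ν : Measure (ℤ → Fin K), IsStationaryLaw ν → allowedWords ν ⊆ S →
    entropyRate ν ≤ entropyRate μ

/-! ### The memoryless erasure channel -/

/-- The i.i.d. erasure process: `E_n = false` (erasure) has probability `ε`. -/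
def erasureLaw (ε : I) : Measure (ℤ → Bool) :=
  Measure.infinitePi fun _ => bernoulliMeasure false true ε

/-- The channel output: `Y_n = X_n` if `E_n = 1`, and the erasure symbol `none` otherwise. -/
def output (p : (ℤ → Fin K) × (ℤ → Bool)) (n : ℤ) : Option (Fin K) :=
  if p.2 n then some (p.1 n) else none

/-- The mutual information rate `I(X; Y) = lim I(X_0^{n-1}; Y_0^{n-1}) / n` of the channel with
erasure rate `ε` and input law `μ`, the erasure process being independent of the input. -/
def mutualInfoRate (μ : Measure (ℤ → Fin K)) (ε : I) : ℝ :=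
  limUnder atTop fun n : ℕ =>
    mutualInfo (μ.prod (erasureLaw ε))
      (fun p (k : Fin n) => p.1 (k : ℤ)) (fun p (k : Fin n) => output p (k : ℤ)) / (n : ℝ)

/-- The capacity `C(S, ε)`. -/
def capacity (S : Set (List (Fin K))) (ε : I) : ℝ :=
  sSup {r | ∃ μ : Measure (ℤ → Fin K),
    IsStationaryLaw μ ∧ allowedWords μ ⊆ S ∧ r = mutualInfoRate μ ε}

/-- The `n`-th order Markov capacity `C⁽ⁿ⁾(S, ε)`. -/
def markovCapacity (n : ℕ) (S : Set (List (Fin K))) (ε : I) : ℝ :=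
  sSup {r | ∃ μ : Measure (ℤ → Fin K),
    IsStationaryLaw μ ∧ IsMarkovOfOrder n μ ∧ allowedWords μ ⊆ S ∧ r = mutualInfoRate μ ε}

/-- The coefficient
`(m + 1) H(X_0 | X_{-m}^{-1}) - ∑_{i=1}^m H(X_0 | X_{-i+1}^{-1}, X_{-i-m}^{-i-1})`. -/
def linearCoeff (m : ℕ) (μ : Measure (ℤ → Fin K)) : ℝ :=
  ((m : ℝ) + 1) * condEntropyZero μ (Finset.Icc (-(m : ℤ)) (-1)) -
    ∑ i ∈ Finset.Icc 1 m,
      condEntropyZero μ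
        (Finset.Icc (-(i : ℤ) + 1) (-1) ∪ Finset.Icc (-(i : ℤ) - m) (-(i : ℤ) - 1))

end ErasureChannel

end

open ErasureChannel

/-!
An erased letter reveals nothing and a received one is read without error, so the mutual information
rate is `1 - ε` times the average of `H(X_0 | X_D)` over the random set `D` of past positions that
survive erasure. This average is at most the one over a finite window of the past, which is
polynomial in `ε`; for a Markov chain the first-order terms of the window estimates stabilise, and
the Markov property collapses them to the stated coefficient.

The maxentropic chain is Parry's, built from the Perron eigenfunctions of the constraint. For a
competitor whose word probabilities are at distance `δ`, the entropy is smaller by at least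
`κ * δ ^ 2`, whereas the first-order coefficient changes by `O(δ)`. It hence gains at most
`O(ε * δ) - κ * δ ^ 2 = O(ε ^ 2)`, and the maxentropic chain is optimal up to `O(ε ^ 2)`.
-/

namespace ErasureChannel

section NegMulLog

open Real

lemma sub_le_mul_log_sub_log {p q : ℝ} (hp : 0 ≤ p) (hq : 0 ≤ q) (hpq : q = 0 → p = 0) :
    p - q ≤ p * (log p - log q) := by
  rcases hp.eq_or_lt with rfl | hp
  · simpa using hq
  have hq : 0 < q := hq.lt_of_ne' fun h => hp.ne' (hpq h)
  have hkl := mul_nonneg hq.le (InformationTheory.klFun_nonneg (div_pos hp hq).le)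
  rw [InformationTheory.klFun, log_div hp.ne' hq.ne', mul_sub, mul_add, ← mul_assoc,
    mul_div_cancel₀ _ hq.ne'] at hkl
  linarith

lemma sub_mul_div_le_mul_log {p u v t : ℝ} (hp : 0 ≤ p) (hpu : p ≤ u) (hpv : p ≤ v)
    (hut : u ≤ t) : p - u * v / t ≤ p * (log p + log t - log u - log v) := by
  rcases hp.eq_or_lt with rfl | hp
  · simpa using div_nonneg (mul_nonneg hpu hpv) (hpu.trans hut)
  have hu := hp.trans_le hpu
  have hv := hp.trans_le hpv
  have ht := hu.trans_le hut
  refine (sub_le_mul_log_sub_log hp.le (by positivity) fun h => ?_).trans_eq ?_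
  · exact absurd h (by positivity)
  · rw [log_div (by positivity) ht.ne', log_mul hu.ne' hv.ne']
    ring

/-- Since `∑ p log (p t / (u v)) ≥ ∑ (p - u v / t) = 0` for the marginals `u`, `v` and the total
mass `t` of `p`. -/
lemma sum_negMulLog_add_negMulLog_sum_le {α γ : Type*} [Fintype α] [Fintype γ]
    (p : α → γ → ℝ) (hp : ∀ a c, 0 ≤ p a c) :
    (∑ a, ∑ c, negMulLog (p a c)) + negMulLog (∑ a, ∑ c, p a c) ≤
      (∑ a, negMulLog (∑ c, p a c)) + ∑ c, negMulLog (∑ a, p a c) := by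
  set u : α → ℝ := fun a => ∑ c, p a c with hu
  set v : γ → ℝ := fun c => ∑ a, p a c with hv
  set t : ℝ := ∑ a, u a with ht
  have hvt : ∑ c, v c = t := Finset.sum_comm
  have hu0 (a) : 0 ≤ u a := Finset.sum_nonneg fun c _ => hp a c
  have hpu (a c) : p a c ≤ u a := Finset.single_le_sum (fun c _ => hp a c) (Finset.mem_univ c)
  have hpv (a c) : p a c ≤ v c :=
    Finset.single_le_sum (f := fun a => p a c) (fun a _ => hp a c) (Finset.mem_univ a)
  have hut (a) : u a ≤ t := Finset.single_le_sum (fun a _ => hu0 a) (Finset.mem_univ a)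
  have hmass : ∑ a, ∑ c, (p a c - u a * v c / t) = 0 := by
    simp only [Finset.sum_sub_distrib, ← Finset.sum_div, ← Finset.mul_sum, ← Finset.sum_mul, hvt]
    rw [← ht, mul_self_div_self, sub_self]
  have hlog : ∑ a, ∑ c, p a c * (log (p a c) + log t - log (u a) - log (v c)) =
      -(∑ a, ∑ c, negMulLog (p a c)) - negMulLog t + ∑ a, negMulLog (u a) +
        ∑ c, negMulLog (v c) := by
    have et : negMulLog t = ∑ a, ∑ c, -(p a c * log t) := by
      simp only [negMulLog, ht, hu, Finset.sum_neg_distrib, ← Finset.sum_mul, neg_mul]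
    have eu : ∑ a, negMulLog (u a) = ∑ a, ∑ c, -(p a c * log (u a)) := by
      simp only [negMulLog, hu, Finset.sum_neg_distrib, ← Finset.sum_mul, neg_mul]
    have ev : ∑ c, negMulLog (v c) = ∑ a, ∑ c, -(p a c * log (v c)) := by
      rw [Finset.sum_comm]
      simp only [negMulLog, hv, Finset.sum_neg_distrib, ← Finset.sum_mul, neg_mul]
    rw [et, eu, ev]
    simp only [← Finset.sum_neg_distrib, ← Finset.sum_sub_distrib, ← Finset.sum_add_distrib]
    refine Finset.sum_congr rfl fun a _ => Finset.sum_congr rfl fun c _ => ?_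
    rw [negMulLog]
    ring
  have hsum := Finset.sum_le_sum fun a (_ : a ∈ Finset.univ) =>
    Finset.sum_le_sum fun c (_ : c ∈ Finset.univ) =>
      sub_mul_div_le_mul_log (hp a c) (hpu a c) (hpv a c) (hut a)
  rw [hmass, hlog] at hsum
  linarith

lemma negMulLog_sum_le {α : Type*} [Fintype α] (p : α → ℝ) (hp : ∀ a, 0 ≤ p a) :
    negMulLog (∑ a, p a) ≤ ∑ a, negMulLog (p a) := by
  rw [negMulLog, neg_mul, Finset.sum_mul, ← Finset.sum_neg_distrib]
  refine Finset.sum_le_sum fun a _ => ?_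
  rw [negMulLog, neg_mul, neg_le_neg_iff]
  rcases (hp a).eq_or_lt with h | h
  · simp [← h]
  · exact mul_le_mul_of_nonneg_left
      (log_le_log h (Finset.single_le_sum (fun a _ => hp a) (Finset.mem_univ a))) h.le

lemma abs_negMulLog_sub_le {p q : ℝ} (hq : 0 < q) (hp : 0 ≤ p) (hp1 : p ≤ 1) :
    |negMulLog p - negMulLog q| ≤ (|log q| + 1 + q⁻¹) * |p - q| := by
  have hlower := sub_le_mul_log_sub_log hp hq.le fun h => absurd h hq.ne'
  have hupper : p * (log p - log q) ≤ p / q * (p - q) := by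
    rcases hp.eq_or_lt with rfl | hp
    · simp
    have hlog := mul_le_mul_of_nonneg_left (log_le_sub_one_of_pos (div_pos hp hq)) hp.le
    rw [log_div hp.ne' hq.ne'] at hlog
    refine hlog.trans_eq ?_
    field_simp
  have habs : |p * (log p - log q)| ≤ (1 + q⁻¹) * |p - q| := by
    have hratio : p / q * |p - q| ≤ q⁻¹ * |p - q| := by
      gcongr
      exact div_le_of_le_mul₀ hq.le (inv_nonneg.2 hq.le) (by rwa [inv_mul_cancel₀ hq.ne'])
    have hle := mul_le_mul_of_nonneg_left (le_abs_self (p - q)) (div_nonneg hp hq.le)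
    have hnonneg := mul_nonneg (inv_nonneg.2 hq.le) (abs_nonneg (p - q))
    rw [abs_le]
    constructor <;> linarith [neg_abs_le (p - q), abs_nonneg (p - q)]
  calc |negMulLog p - negMulLog q| = |(p - q) * log q + p * (log p - log q)| := by
        rw [← abs_neg, negMulLog, negMulLog]
        ring_nf
    _ ≤ |p - q| * |log q| + |p * (log p - log q)| := by
        rw [← abs_mul]
        exact abs_add_le _ _
    _ ≤ (|log q| + 1 + q⁻¹) * |p - q| := by linarith

end NegMulLog

lemma preimage_pair_singleton {Ω α β : Type*} (A : Ω → α) (B : Ω → β) (a : α) (b : β) :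
    (fun x => (A x, B x)) ⁻¹' {(a, b)} = A ⁻¹' {a} ∩ B ⁻¹' {b} := by
  ext; simp

section RandomVariables

variable {Ω α β γ : Type*} [MeasurableSpace Ω] {μ : Measure Ω}

lemma entropy_comp_of_injective [Fintype α] [Fintype β] (A : Ω → α) {f : α → β}
    (hf : Function.Injective f) : entropy μ (f ∘ A) = entropy μ A := by
  refine (Fintype.sum_of_injective f hf _ _ (fun b hb => ?_) fun a => ?_).symm
  · have hempty : f ∘ A ⁻¹' {b} = ∅ :=
      Set.eq_empty_of_forall_notMem fun x hx => hb ⟨A x, hx⟩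
    simp [hempty]
  · congr 2
    ext x
    exact hf.eq_iff.symm

lemma entropy_congr [Fintype α] [Fintype β] {A : Ω → α} {B : Ω → β}
    (h : ∀ x y, A x = A y ↔ B x = B y) : entropy μ A = entropy μ B := by
  classical
  have hB (r : Set.range A) {x : Ω} (hx : A x = r) : B r.2.choose = B x :=
    (h _ _).1 (r.2.choose_spec.trans hx.symm)
  have hinj : Function.Injective fun r : Set.range A => B r.2.choose := fun r s hrs =>
    Subtype.ext (r.2.choose_spec.symm.trans (((h _ _).2 hrs).trans s.2.choose_spec))
  have hBA : B = (fun r : Set.range A => B r.2.choose) ∘ Set.rangeFactorization A :=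
    funext fun x => (hB (Set.rangeFactorization A x) rfl).symm
  rw [hBA, entropy_comp_of_injective _ hinj]
  exact entropy_comp_of_injective (Set.rangeFactorization A) Subtype.val_injective

lemma entropy_le_card [Fintype α] (A : Ω → α) : entropy μ A ≤ Fintype.card α := by
  refine (Finset.sum_le_card_nsmul _ _ 1 fun a _ => ?_).trans (by simp)
  exact (Real.negMulLog_le_one_sub_self measureReal_nonneg).trans (by simp)

lemma entropy_of_subsingleton [Fintype α] [Subsingleton α] [IsProbabilityMeasure μ] (A : Ω → α) :
    entropy μ A = 0 := by
  refine Finset.sum_eq_zero fun a _ => ?_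
  have : A ⁻¹' {a} = Set.univ := Set.eq_univ_of_forall fun x => Subsingleton.elim (A x) a
  simp [this]

variable (μ) in
lemma exists_abs_entropy_sub_le [Fintype α] (A : Ω → α) :
    ∃ L, 0 ≤ L ∧ ∀ ν : Measure Ω, IsProbabilityMeasure ν →
      (∀ a, μ.real (A ⁻¹' {a}) = 0 → ν.real (A ⁻¹' {a}) = 0) →
      |entropy ν A - entropy μ A| ≤ L * ∑ a, |ν.real (A ⁻¹' {a}) - μ.real (A ⁻¹' {a})| := by
  let l (a : α) : ℝ := |Real.log (μ.real (A ⁻¹' {a}))| + 1 + (μ.real (A ⁻¹' {a}))⁻¹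
  have hl (a : α) : 0 ≤ l a := by positivity
  refine ⟨∑ a, l a, Finset.sum_nonneg fun a _ => hl a, fun ν _ hνμ => ?_⟩
  rw [entropy, entropy, ← Finset.sum_sub_distrib, Finset.mul_sum]
  refine (Finset.abs_sum_le_sum_abs _ _).trans (Finset.sum_le_sum fun a _ => ?_)
  have hterm : |Real.negMulLog (ν.real (A ⁻¹' {a})) - Real.negMulLog (μ.real (A ⁻¹' {a}))| ≤
      l a * |ν.real (A ⁻¹' {a}) - μ.real (A ⁻¹' {a})| := by
    rcases (measureReal_nonneg (μ := μ) (s := A ⁻¹' {a})).eq_or_lt with h0 | hpos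
    · simp [hνμ a h0.symm, ← h0]
    · exact abs_negMulLog_sub_le hpos measureReal_nonneg measureReal_le_one
  refine hterm.trans ?_
  gcongr
  exact Finset.single_le_sum (fun a _ => hl a) (Finset.mem_univ a)

variable [IsFiniteMeasure μ]

lemma sum_measureReal_inter_preimage_singleton [Fintype β] [MeasurableSpace β]
    [MeasurableSingletonClass β] (s : Set Ω) {B : Ω → β} (hB : Measurable B) :
    ∑ b, μ.real (s ∩ B ⁻¹' {b}) = μ.real s := by
  have h := sum_measureReal_preimage_singleton (μ := μ.restrict s) (Finset.univ : Finset β)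
    (f := B) fun b _ => hB (measurableSet_singleton b)
  simpa [measureReal_restrict_apply (hB (measurableSet_singleton _)), Set.inter_comm] using h

variable [Fintype α] [Fintype β] [MeasurableSpace α] [MeasurableSingletonClass α]

lemma condEntropy_eq_sub {A : Ω → α} (B : Ω → β) (hA : Measurable A) :
    condEntropy μ A B = entropy μ (fun x => (A x, B x)) - entropy μ B := by
  have entropy_eq : entropy μ B =
      ∑ a, ∑ b, -(μ.real (A ⁻¹' {a} ∩ B ⁻¹' {b}) * Real.log (μ.real (B ⁻¹' {b}))) := by
    rw [Finset.sum_comm]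
    refine Finset.sum_congr rfl fun b _ => ?_
    simp only [Finset.sum_neg_distrib, ← Finset.sum_mul, Set.inter_comm _ (B ⁻¹' {b}),
      sum_measureReal_inter_preimage_singleton _ hA, Real.negMulLog, neg_mul]
  rw [entropy_eq, entropy, Fintype.sum_prod_type, condEntropy]
  simp only [preimage_pair_singleton, ← Finset.sum_neg_distrib, ← Finset.sum_sub_distrib]
  refine Finset.sum_congr rfl fun a _ => Finset.sum_congr rfl fun b _ => ?_
  by_cases h : μ.real (A ⁻¹' {a} ∩ B ⁻¹' {b}) = 0
  · simp [h]
  · have h' : μ.real (B ⁻¹' {b}) ≠ 0 := fun h0 =>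
      h (le_antisymm (h0 ▸ measureReal_mono Set.inter_subset_right) measureReal_nonneg)
    rw [Real.log_div h h', Real.negMulLog]
    ring

lemma entropy_submodular [Fintype γ] [MeasurableSpace γ] [MeasurableSingletonClass γ]
    {A : Ω → α} (B : Ω → β) {C : Ω → γ} (hA : Measurable A) (hC : Measurable C) :
    entropy μ (fun x => (A x, B x, C x)) + entropy μ B ≤
      entropy μ (fun x => (A x, B x)) + entropy μ (fun x => (B x, C x)) := by
  have sum_c (a b) : ∑ c, μ.real (A ⁻¹' {a} ∩ (B ⁻¹' {b} ∩ C ⁻¹' {c})) =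
      μ.real (A ⁻¹' {a} ∩ B ⁻¹' {b}) := by
    simp only [← Set.inter_assoc, sum_measureReal_inter_preimage_singleton _ hC]
  have sum_a (s : Set Ω) : ∑ a, μ.real (A ⁻¹' {a} ∩ s) = μ.real s := by
    simp only [Set.inter_comm _ s, sum_measureReal_inter_preimage_singleton _ hA]
  have h := Finset.sum_le_sum fun b (_ : b ∈ Finset.univ) => sum_negMulLog_add_negMulLog_sum_le
    (fun a c => μ.real (A ⁻¹' {a} ∩ (B ⁻¹' {b} ∩ C ⁻¹' {c}))) fun _ _ => measureReal_nonneg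
  simp only [sum_c, sum_a, Finset.sum_add_distrib] at h
  simp only [entropy, Fintype.sum_prod_type, preimage_pair_singleton]
  rw [Finset.sum_comm, Finset.sum_comm (s := (Finset.univ : Finset α)) (t := Finset.univ)
    (f := fun a b => (μ.real (A ⁻¹' {a} ∩ B ⁻¹' {b})).negMulLog)]
  exact h

lemma entropy_le_entropy_pair {A : Ω → α} (B : Ω → β) (hA : Measurable A) :
    entropy μ B ≤ entropy μ (fun x => (A x, B x)) := by
  rw [entropy, entropy, Fintype.sum_prod_type_right]
  refine Finset.sum_le_sum fun b _ => ?_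
  rw [← sum_measureReal_inter_preimage_singleton _ hA]
  simp only [preimage_pair_singleton, Set.inter_comm _ (B ⁻¹' {b})]
  exact negMulLog_sum_le _ fun _ => measureReal_nonneg

lemma measureReal_comp_preimage_singleton [DecidableEq γ] {X : Ω → α} (hX : Measurable X)
    (f : α → γ) (c : γ) :
    μ.real ((fun x => f (X x)) ⁻¹' {c}) = ∑ a with f a = c, μ.real (X ⁻¹' {a}) := by
  rw [sum_measureReal_preimage_singleton _ fun a _ => hX (measurableSet_singleton a)]
  congr 1
  ext x
  simp

variable (μ) in
lemma exists_abs_entropy_comp_sub_le [Fintype γ] {X : Ω → α} (hX : Measurable X)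
    (f : α → γ) : ∃ L, 0 ≤ L ∧ ∀ ν : Measure Ω, IsProbabilityMeasure ν →
      (∀ a, μ.real (X ⁻¹' {a}) = 0 → ν.real (X ⁻¹' {a}) = 0) →
      |entropy ν (fun x => f (X x)) - entropy μ (fun x => f (X x))| ≤
        L * ∑ a, |ν.real (X ⁻¹' {a}) - μ.real (X ⁻¹' {a})| := by
  classical
  obtain ⟨L, hL, hle⟩ := exists_abs_entropy_sub_le μ fun x => f (X x)
  refine ⟨L, hL, fun ν hν hνμ => (hle ν hν fun c => ?_).trans ?_⟩
  · simp only [measureReal_comp_preimage_singleton hX,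
      Finset.sum_eq_zero_iff_of_nonneg fun _ _ => measureReal_nonneg]
    exact fun h a ha => hνμ a (h a ha)
  · gcongr
    simp only [measureReal_comp_preimage_singleton hX, ← Finset.sum_sub_distrib]
    rw [← Finset.sum_fiberwise Finset.univ f]
    exact Finset.sum_le_sum fun c _ => Finset.abs_sum_le_sum_abs _ _

end RandomVariables

section ErasureAverage

variable {ι : Type*}

/-- The average of `f D` over the random set `D` of the points of `s` that are kept when each
point is erased independently with probability `ε`. -/
noncomputable def erasureAvg (ε : ℝ) (s : Finset ι) (f : Finset ι → ℝ) : ℝ :=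
  ∑ D ∈ s.powerset, (1 - ε) ^ D.card * ε ^ (s.card - D.card) * f D

lemma erasureAvg_empty (ε : ℝ) (f : Finset ι → ℝ) : erasureAvg ε ∅ f = f ∅ := by
  simp [erasureAvg]

lemma erasureAvg_zero (s : Finset ι) (f : Finset ι → ℝ) : erasureAvg 0 s f = f s := by
  rw [erasureAvg, Finset.sum_eq_single_of_mem s (Finset.mem_powerset_self s)]
  · simp
  · intro D hD hne
    have hlt := Finset.card_lt_card ((Finset.mem_powerset.1 hD).ssubset_of_ne hne)
    rw [zero_pow (Nat.sub_ne_zero_of_lt hlt)]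
    ring

lemma erasureAvg_sub (ε : ℝ) (s : Finset ι) (f g : Finset ι → ℝ) :
    erasureAvg ε s (fun D => f D - g D) = erasureAvg ε s f - erasureAvg ε s g := by
  simp only [erasureAvg, mul_sub, Finset.sum_sub_distrib]

lemma erasureAvg_mono {ε : ℝ} (h0 : 0 ≤ ε) (h1 : ε ≤ 1) {s : Finset ι} {f g : Finset ι → ℝ}
    (h : ∀ D ⊆ s, f D ≤ g D) : erasureAvg ε s f ≤ erasureAvg ε s g := by
  refine Finset.sum_le_sum fun D hD => ?_
  have : 0 ≤ 1 - ε := sub_nonneg.2 h1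
  exact mul_le_mul_of_nonneg_left (h D (Finset.mem_powerset.1 hD)) (by positivity)

lemma erasureAvg_insert [DecidableEq ι] (ε : ℝ) {s : Finset ι} {i : ι} (hi : i ∉ s)
    (f : Finset ι → ℝ) :
    erasureAvg ε (insert i s) f =
      (1 - ε) * erasureAvg ε s (fun D => f (insert i D)) + ε * erasureAvg ε s f := by
  rw [erasureAvg, Finset.sum_powerset_insert hi, add_comm, erasureAvg, erasureAvg,
    Finset.mul_sum, Finset.mul_sum]
  congr 1 <;> refine Finset.sum_congr rfl fun D hD => ?_ <;> rw [Finset.mem_powerset] at hD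
  · rw [Finset.card_insert_of_notMem hi, Finset.card_insert_of_notMem fun h => hi (hD h),
      Nat.add_sub_add_right]
    ring
  · rw [Finset.card_insert_of_notMem hi, Nat.succ_sub (Finset.card_le_card hD), pow_succ]
    ring

lemma erasureAvg_const (ε : ℝ) (s : Finset ι) (c : ℝ) : erasureAvg ε s (fun _ => c) = c := by
  classical
  induction s using Finset.induction_on with
  | empty => rw [erasureAvg_empty]
  | insert i s hi ih => rw [erasureAvg_insert ε hi, ih]; ring

lemma abs_erasureAvg_le {ε : ℝ} (h0 : 0 ≤ ε) (h1 : ε ≤ 1) {s : Finset ι} {f : Finset ι → ℝ}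
    {M : ℝ} (h : ∀ D ⊆ s, |f D| ≤ M) : |erasureAvg ε s f| ≤ M := by
  rw [abs_le, ← erasureAvg_const ε s (-M)]
  nth_rw 2 [← erasureAvg_const ε s M]
  exact ⟨erasureAvg_mono h0 h1 fun D hD => (abs_le.1 (h D hD)).1,
    erasureAvg_mono h0 h1 fun D hD => (abs_le.1 (h D hD)).2⟩

lemma erasureAvg_image {κ : Type*} [DecidableEq κ] (ε : ℝ) (s : Finset ι) {e : ι → κ}
    (he : Function.Injective e) (f : Finset κ → ℝ) :
    erasureAvg ε (s.image e) f = erasureAvg ε s (fun D => f (D.image e)) := by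
  classical
  induction s using Finset.induction_on generalizing f with
  | empty => simp only [erasureAvg_empty, Finset.image_empty]
  | insert i s hi ih =>
    rw [Finset.image_insert, erasureAvg_insert ε (by simpa [he.eq_iff] using hi),
      erasureAvg_insert ε hi, ih, ih]
    simp only [Finset.image_insert]

lemma abs_erasureAvg_sub_le {ε : ℝ} (h0 : 0 ≤ ε) (h1 : ε ≤ 1) {s : Finset ι}
    {f : Finset ι → ℝ} {M : ℝ} (hf : ∀ D ⊆ s, |f D| ≤ M) :
    |erasureAvg ε s f - f s| ≤ 2 * s.card * M * ε := by
  classical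
  induction s using Finset.induction_on generalizing f with
  | empty => simp [erasureAvg_empty]
  | insert i s hi ih =>
    have hf' : ∀ D ⊆ s, |f D| ≤ M := fun D hD => hf D (hD.trans (Finset.subset_insert i s))
    have hkept := ih fun D hD => hf (insert i D) (Finset.insert_subset_insert i hD)
    have herased : |erasureAvg ε s f - f (insert i s)| ≤ 2 * M :=
      (abs_sub _ _).trans (by linarith [abs_erasureAvg_le h0 h1 hf', hf _ subset_rfl])
    rw [erasureAvg_insert ε hi, Finset.card_insert_of_notMem hi]
    push_cast
    calc |(1 - ε) * erasureAvg ε s (fun D => f (insert i D)) + ε * erasureAvg ε s f -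
            f (insert i s)|
        = |(1 - ε) * (erasureAvg ε s (fun D => f (insert i D)) - f (insert i s)) +
            ε * (erasureAvg ε s f - f (insert i s))| := by congr 1; ring
      _ ≤ (1 - ε) * |erasureAvg ε s (fun D => f (insert i D)) - f (insert i s)| +
            ε * |erasureAvg ε s f - f (insert i s)| := by
          refine (abs_add_le _ _).trans_eq ?_
          rw [abs_mul, abs_mul, abs_of_nonneg h0, abs_of_nonneg (sub_nonneg.2 h1)]
      _ ≤ 1 * (2 * s.card * M * ε) + ε * (2 * M) := by
          gcongr
          linarith
      _ = 2 * (s.card + 1) * M * ε := by ring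

variable [DecidableEq ι]

lemma erasureAvg_union_le {ε : ℝ} (h0 : 0 ≤ ε) (h1 : ε ≤ 1) (s t : Finset ι)
    {f : Finset ι → ℝ} (hf : Antitone f) : erasureAvg ε (s ∪ t) f ≤ erasureAvg ε s f := by
  induction t using Finset.induction_on with
  | empty => simp
  | insert i t _ ih =>
    rw [Finset.union_insert]
    by_cases h : i ∈ s ∪ t
    · rwa [Finset.insert_eq_of_mem h]
    · rw [erasureAvg_insert ε h]
      have := erasureAvg_mono (s := s ∪ t) h0 h1 fun D _ => hf (Finset.subset_insert i D)
      nlinarith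

lemma le_erasureAvg_union {ε : ℝ} (h0 : 0 ≤ ε) (h1 : ε ≤ 1) {s t : Finset ι}
    {f : Finset ι → ℝ} (hf : Antitone f) (hst : Disjoint s t) :
    erasureAvg ε s (fun D => f (D ∪ t)) ≤ erasureAvg ε (s ∪ t) f := by
  induction t using Finset.induction_on generalizing f with
  | empty => simp
  | insert i t hi ih =>
    rw [Finset.disjoint_insert_right] at hst
    have h : i ∉ s ∪ t := by simp [hst.1, hi]
    rw [Finset.union_insert, erasureAvg_insert ε h]
    have hmono := erasureAvg_mono (s := s ∪ t) h0 h1 fun D _ => hf (Finset.subset_insert i D)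
    have hins := ih (f := fun D => f (insert i D))
      (fun D E hDE => hf (Finset.insert_subset_insert i hDE)) hst.2
    simp only [Finset.union_insert]
    nlinarith

lemma abs_sum_erase_sub_le {s : Finset ι} {f : Finset ι → ℝ} {M : ℝ}
    (hf : ∀ D ⊆ s, |f D| ≤ M) : |∑ i ∈ s, (f (s.erase i) - f s)| ≤ 2 * s.card * M := by
  refine (Finset.abs_sum_le_sum_abs _ _).trans ?_
  refine (Finset.sum_le_card_nsmul _ _ (2 * M) fun i _ => ?_).trans_eq ?_
  · exact (abs_sub _ _).trans (by linarith [hf _ (Finset.erase_subset i s), hf _ subset_rfl])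
  · rw [nsmul_eq_mul]
    ring

lemma abs_erasureAvg_sub_firstOrder_le {ε : ℝ} (h0 : 0 ≤ ε) (h1 : ε ≤ 1) {s : Finset ι}
    {f : Finset ι → ℝ} {M : ℝ} (hf : ∀ D ⊆ s, |f D| ≤ M) :
    |erasureAvg ε s f - (f s + ε * ∑ i ∈ s, (f (s.erase i) - f s))| ≤
      2 * s.card ^ 2 * M * ε ^ 2 := by
  induction s using Finset.induction_on generalizing f with
  | empty => simp [erasureAvg_empty]
  | insert i s hi ih =>
    have hM : 0 ≤ M := (abs_nonneg _).trans (hf _ subset_rfl)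
    have hins : ∀ D ⊆ s, |f (insert i D)| ≤ M := fun D hD =>
      hf (insert i D) (Finset.insert_subset_insert i hD)
    have hkept := ih hins
    have herased := abs_erasureAvg_sub_le h0 h1 fun D (hD : D ⊆ s) =>
      hf D (hD.trans (Finset.subset_insert i s))
    have hsum := abs_sum_erase_sub_le hins
    have erase_insert : ∑ j ∈ s, (f ((insert i s).erase j) - f (insert i s)) =
        ∑ j ∈ s, (f (insert i (s.erase j)) - f (insert i s)) := by
      refine Finset.sum_congr rfl fun j hj => ?_
      rw [Finset.erase_insert_of_ne (by rintro rfl; exact hi hj)]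
    rw [erasureAvg_insert ε hi, Finset.sum_insert hi, Finset.erase_insert hi, erase_insert,
      Finset.card_insert_of_notMem hi]
    push_cast
    set A := erasureAvg ε s fun D => f (insert i D)
    set B := erasureAvg ε s f
    set F := f (insert i s)
    set Q := ∑ j ∈ s, (f (insert i (s.erase j)) - F)
    calc |(1 - ε) * A + ε * B - (F + ε * (f s - F + Q))|
        = |(1 - ε) * (A - (F + ε * Q)) + ε * (B - f s) + -(ε ^ 2) * Q| := by congr 1; ring
      _ ≤ (1 - ε) * |A - (F + ε * Q)| + ε * |B - f s| + ε ^ 2 * |Q| := by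
          refine (abs_add_three _ _ _).trans_eq ?_
          rw [abs_mul, abs_mul, abs_mul, abs_of_nonneg h0, abs_of_nonneg (sub_nonneg.2 h1),
            abs_neg, abs_of_nonneg (sq_nonneg ε)]
      _ ≤ 1 * (2 * s.card ^ 2 * M * ε ^ 2) + ε * (2 * s.card * M * ε) +
            ε ^ 2 * (2 * s.card * M) := by
          gcongr
          linarith
      _ ≤ 2 * (s.card + 1) ^ 2 * M * ε ^ 2 := by
          have : 0 ≤ M * ε ^ 2 := by positivity
          linarith

/-- The coefficient of `ε` in the expansion of `(1 - ε) * erasureAvg ε s f`: the point whose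
symbol is observed and each point of `s` contribute one erasure. -/
noncomputable def erasureSlope (s : Finset ι) (f : Finset ι → ℝ) : ℝ :=
  ∑ i ∈ s, f (s.erase i) - (s.card + 1) * f s

lemma abs_one_sub_mul_erasureAvg_sub_le {ε : ℝ} (h0 : 0 ≤ ε) (h1 : ε ≤ 1) {s : Finset ι}
    {f : Finset ι → ℝ} {M : ℝ} (hf : ∀ D ⊆ s, |f D| ≤ M) :
    |(1 - ε) * erasureAvg ε s f - (f s + ε * erasureSlope s f)| ≤
      2 * s.card * (s.card + 1) * M * ε ^ 2 := by
  have havg := abs_erasureAvg_sub_firstOrder_le h0 h1 hf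
  have hsum := abs_sum_erase_sub_le hf
  have hslope : erasureSlope s f = ∑ i ∈ s, (f (s.erase i) - f s) - f s := by
    rw [erasureSlope, Finset.sum_sub_distrib, Finset.sum_const, nsmul_eq_mul]
    ring
  rw [hslope]
  set Q := ∑ i ∈ s, (f (s.erase i) - f s)
  set A := erasureAvg ε s f
  calc |(1 - ε) * A - (f s + ε * (Q - f s))|
      = |(1 - ε) * (A - (f s + ε * Q)) + -(ε ^ 2) * Q| := by congr 1; ring
    _ ≤ (1 - ε) * |A - (f s + ε * Q)| + ε ^ 2 * |Q| := by
        refine (abs_add_le _ _).trans_eq ?_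
        rw [abs_mul, abs_mul, abs_of_nonneg (sub_nonneg.2 h1), abs_neg,
          abs_of_nonneg (sq_nonneg ε)]
    _ ≤ 1 * (2 * s.card ^ 2 * M * ε ^ 2) + ε ^ 2 * (2 * s.card * M) := by
        gcongr
        linarith
    _ = 2 * s.card * (s.card + 1) * M * ε ^ 2 := by ring

lemma abs_erasureSlope_sub_le {s : Finset ι} {f g : Finset ι → ℝ} {M : ℝ}
    (h : ∀ D ⊆ s, |f D - g D| ≤ M) :
    |erasureSlope s f - erasureSlope s g| ≤ (2 * s.card + 1) * M := by
  calc |erasureSlope s f - erasureSlope s g|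
      = |∑ i ∈ s, (f (s.erase i) - g (s.erase i)) - (s.card + 1) * (f s - g s)| := by
        rw [erasureSlope, erasureSlope, Finset.sum_sub_distrib]
        congr 1
        ring
    _ ≤ s.card * M + (s.card + 1) * M := by
        refine (abs_sub _ _).trans (add_le_add ?_ ?_)
        · rw [← nsmul_eq_mul]
          exact (Finset.abs_sum_le_sum_abs _ _).trans
            (Finset.sum_le_card_nsmul _ _ _ fun i _ => h _ (Finset.erase_subset i s))
        · rw [abs_mul, abs_of_nonneg (by positivity)]
          gcongr
          exact h s subset_rfl
    _ = (2 * s.card + 1) * M := by ring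

end ErasureAverage

section BlockEntropy

lemma restrict_eq_iff {ι α : Type*} (D : Finset ι) (x y : ι → α) :
    (fun d : D => x d) = (fun d : D => y d) ↔ ∀ d ∈ D, x d = y d := by
  simp [funext_iff]

variable {ι α : Type*} [DecidableEq ι] [Fintype α] [MeasurableSpace α]

/-- The joint entropy of the coordinates in `D` of a random family with law `μ`. -/
noncomputable def blockEntropy (μ : Measure (ι → α)) (D : Finset ι) : ℝ :=
  entropy μ (fun x (d : D) => x d)

variable [MeasurableSingletonClass α] (μ : Measure (ι → α)) [IsFiniteMeasure μ]

lemma monotone_blockEntropy : Monotone (blockEntropy μ) := by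
  intro D E hDE
  refine (entropy_le_entropy_pair (A := fun x (d : E) => x d) _ (by fun_prop)).trans_eq ?_
  refine entropy_congr fun x y => ?_
  rw [Prod.mk.injEq, restrict_eq_iff, restrict_eq_iff]
  exact ⟨fun h => h.1, fun h => ⟨h, fun d hd => h d (hDE hd)⟩⟩

lemma blockEntropy_union_add_inter_le (D E : Finset ι) :
    blockEntropy μ (D ∪ E) + blockEntropy μ (D ∩ E) ≤ blockEntropy μ D + blockEntropy μ E := by
  have h := entropy_submodular (μ := μ) (A := fun x (d : D) => x d)
    (fun x (d : (D ∩ E : Finset ι)) => x d) (C := fun x (d : E) => x d)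
    (by fun_prop) (by fun_prop)
  refine Eq.trans_le ?_ (h.trans_eq ?_)
  · congr 1
    refine entropy_congr fun x y => ?_
    simp only [Prod.mk.injEq, restrict_eq_iff, Finset.mem_union, Finset.mem_inter]
    grind
  · congr 1 <;>
    · refine entropy_congr fun x y => ?_
      simp only [Prod.mk.injEq, restrict_eq_iff, Finset.mem_inter]
      grind

end BlockEntropy

section Stationary

/-- The properties of the joint entropies `D ↦ H(X_D)` of a stationary process that determine the
erasure asymptotics; `M` bounds the entropy of one symbol. -/
structure IsStationaryEntropy (H : Finset ℤ → ℝ) (M : ℝ) : Prop where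
  empty : H ∅ = 0
  mono : Monotone H
  submodular : ∀ D E, H (D ∪ E) + H (D ∩ E) ≤ H D + H E
  image_add : ∀ D t, H (D.image (· + t)) = H D
  singleton_le : H {0} ≤ M

variable {K : ℕ} {μ : Measure (ℤ → Fin K)}

lemma IsStationaryLaw.blockEntropy_image_add_one (hμ : IsStationaryLaw μ) (D : Finset ℤ) :
    blockEntropy μ (D.image (· + 1)) = blockEntropy μ D := by
  have restrict_shift : blockEntropy μ (D.image (· + 1)) =
      entropy μ (fun x (d : D) => shift x (d : ℤ)) := by
    refine entropy_congr fun x y => ?_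
    rw [restrict_eq_iff, restrict_eq_iff, Finset.forall_mem_image]
    rfl
  rw [restrict_shift, blockEntropy, entropy, entropy]
  refine Finset.sum_congr rfl fun z _ => ?_
  have hz : MeasurableSet ((fun (x : ℤ → Fin K) (d : D) => x d) ⁻¹' {z}) :=
    (by fun_prop : Measurable fun (x : ℤ → Fin K) (d : D) => x d) (measurableSet_singleton z)
  rw [← hμ.measurePreserving.measureReal_preimage hz.nullMeasurableSet]
  rfl

lemma IsStationaryLaw.blockEntropy_image_add (hμ : IsStationaryLaw μ) (D : Finset ℤ) (t : ℤ) :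
    blockEntropy μ (D.image (· + t)) = blockEntropy μ D := by
  have image_add_nat (n : ℕ) (D : Finset ℤ) :
      blockEntropy μ (D.image (· + (n : ℤ))) = blockEntropy μ D := by
    induction n generalizing D with
    | zero => simp
    | succ n ih =>
      rw [← ih D, ← hμ.blockEntropy_image_add_one (D.image (· + (n : ℤ))), Finset.image_image]
      congr 2
      ext i
      simp [add_assoc]
  obtain ⟨n, rfl | rfl⟩ := t.eq_nat_or_neg
  · exact image_add_nat n D
  · rw [← image_add_nat n (D.image _), Finset.image_image]
    simp [Function.comp_def]

lemma IsStationaryLaw.isStationaryEntropy (hμ : IsStationaryLaw μ) :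
    IsStationaryEntropy (blockEntropy μ) K where
  empty :=
    have := hμ.isProbabilityMeasure
    entropy_of_subsingleton _
  mono :=
    have := hμ.isProbabilityMeasure
    monotone_blockEntropy μ
  submodular :=
    have := hμ.isProbabilityMeasure
    blockEntropy_union_add_inter_le μ
  image_add := hμ.blockEntropy_image_add
  singleton_le := by
    have := hμ.isProbabilityMeasure
    refine (entropy_congr (B := fun x : ℤ → Fin K => x 0) fun x y => ?_).trans_le
      ((entropy_le_card _).trans_eq (by simp))
    simp [restrict_eq_iff]

lemma condEntropyZero_eq_sub (μ : Measure (ℤ → Fin K)) [IsFiniteMeasure μ] (D : Finset ℤ) :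
    condEntropyZero μ D = blockEntropy μ (insert 0 D) - blockEntropy μ D := by
  rw [condEntropyZero, condEntropy_eq_sub (A := fun x : ℤ → Fin K => x 0) _ (by fun_prop)]
  congr 1
  refine entropy_congr fun x y => ?_
  simp [restrict_eq_iff]

end Stationary

/-- The `n` times preceding time `0`. -/
noncomputable def past (n : ℕ) : Finset ℤ := Finset.Ico (-(n : ℤ)) 0

lemma mem_past {n : ℕ} {i : ℤ} : i ∈ past n ↔ -(n : ℤ) ≤ i ∧ i < 0 := Finset.mem_Ico

lemma card_past (n : ℕ) : (past n).card = n := by simp [past]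

/-- The increment `H(X_0 | X_D) = H(X_0, X_D) - H(X_D)` of an entropy function. -/
def increment (H : Finset ℤ → ℝ) (D : Finset ℤ) : ℝ := H (insert 0 D) - H D

/-- The limit of the average of `H(X_0 | X_D)` when `D` is a random set of past times, each of
which is erased with probability `ε`; the averages decrease as the window of the past grows. -/
noncomputable def incrementRate (H : Finset ℤ → ℝ) (ε : ℝ) : ℝ :=
  ⨅ n, erasureAvg ε (past n) (increment H)

namespace IsStationaryEntropy

variable {H : Finset ℤ → ℝ} {M : ℝ}

lemma union_sub_union_le (hH : IsStationaryEntropy H M) {A B C C' : Finset ℤ} (hBA : B ⊆ A)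
    (hC : C ⊆ C') : H (C' ∪ A) - H (C ∪ A) ≤ H (C' ∪ B) - H (C ∪ B) := by
  have hsub := hH.submodular (C' ∪ B) (C ∪ A)
  have hunion : C' ∪ B ∪ (C ∪ A) = C' ∪ A := by grind
  have hinter : H (C ∪ B) ≤ H ((C' ∪ B) ∩ (C ∪ A)) := hH.mono (by grind)
  rw [hunion] at hsub
  linarith

lemma union_sub_eq_of_union_sub_eq (hH : IsStationaryEntropy H M) {A B C C' : Finset ℤ}
    (hBA : B ⊆ A) (hC : C ⊆ C') (h : H (C' ∪ A) - H A = H (C' ∪ B) - H B) :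
    H (C ∪ A) - H A = H (C ∪ B) - H B := by
  have hfirst := hH.union_sub_union_le hBA (Finset.empty_subset C)
  have hrest := hH.union_sub_union_le hBA hC
  rw [Finset.empty_union, Finset.empty_union] at hfirst
  linarith

lemma antitone_increment (hH : IsStationaryEntropy H M) : Antitone (increment H) := by
  intro D E hDE
  simpa [increment] using hH.union_sub_union_le hDE (Finset.empty_subset {0})

lemma increment_nonneg (hH : IsStationaryEntropy H M) (D : Finset ℤ) : 0 ≤ increment H D :=
  sub_nonneg.2 (hH.mono (Finset.subset_insert _ _))

lemma increment_le (hH : IsStationaryEntropy H M) (D : Finset ℤ) : increment H D ≤ M := by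
  refine (hH.antitone_increment (Finset.empty_subset D)).trans ?_
  simpa [increment, hH.empty] using hH.singleton_le

lemma abs_increment_le (hH : IsStationaryEntropy H M) (D : Finset ℤ) : |increment H D| ≤ M := by
  rw [abs_of_nonneg (hH.increment_nonneg D)]
  exact hH.increment_le D

lemma erasureAvg_Ico_succ (hH : IsStationaryEntropy H M) (ε : ℝ) (n : ℕ) :
    erasureAvg ε (Finset.Ico 0 ((n + 1 : ℕ) : ℤ)) H = erasureAvg ε (Finset.Ico 0 (n : ℤ)) H +
      (1 - ε) * erasureAvg ε (past n) (increment H) := by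
  have insert_last : Finset.Ico 0 ((n + 1 : ℕ) : ℤ) = insert (n : ℤ) (Finset.Ico 0 (n : ℤ)) := by
    ext x
    simp only [Finset.mem_Ico, Finset.mem_insert]
    omega
  have image_past : Finset.Ico 0 (n : ℤ) = (past n).image (· + (n : ℤ)) := by
    ext x
    simp [past]
  have shift_increment : erasureAvg ε (past n) (increment H) =
      erasureAvg ε (Finset.Ico 0 (n : ℤ)) (fun D => H (insert (n : ℤ) D) - H D) := by
    rw [image_past, erasureAvg_image ε _ (add_left_injective _)]
    congr 1
    ext D
    have : insert (n : ℤ) (D.image (· + (n : ℤ))) = (insert 0 D).image (· + (n : ℤ)) := by simp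
    rw [this, hH.image_add, hH.image_add, increment]
  rw [insert_last, erasureAvg_insert ε (by simp), shift_increment, erasureAvg_sub]
  ring

lemma erasureAvg_Ico_eq_sum (hH : IsStationaryEntropy H M) (ε : ℝ) (n : ℕ) :
    erasureAvg ε (Finset.Ico 0 (n : ℤ)) H =
      ∑ k ∈ Finset.range n, (1 - ε) * erasureAvg ε (past k) (increment H) := by
  induction n with
  | zero => simp [erasureAvg_empty, hH.empty]
  | succ n ih => rw [hH.erasureAvg_Ico_succ, ih, Finset.sum_range_succ]

section Rate

variable {ε : ℝ}

lemma antitone_erasureAvg_past (hH : IsStationaryEntropy H M) (h0 : 0 ≤ ε) (h1 : ε ≤ 1) :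
    Antitone fun n => erasureAvg ε (past n) (increment H) := by
  refine antitone_nat_of_succ_le fun n => ?_
  have past_succ : past (n + 1) = past n ∪ {-((n + 1 : ℕ) : ℤ)} := by
    ext x
    simp only [Finset.mem_union, mem_past, Finset.mem_singleton]
    omega
  rw [past_succ]
  exact erasureAvg_union_le h0 h1 _ _ hH.antitone_increment

lemma bddBelow_erasureAvg_past (hH : IsStationaryEntropy H M) (h0 : 0 ≤ ε) (h1 : ε ≤ 1) :
    BddBelow (Set.range fun n => erasureAvg ε (past n) (increment H)) := by
  refine ⟨0, Set.forall_mem_range.2 fun n => ?_⟩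
  rw [← erasureAvg_const ε (past n) 0]
  exact erasureAvg_mono h0 h1 fun D _ => hH.increment_nonneg D

lemma tendsto_erasureAvg_div (hH : IsStationaryEntropy H M) (h0 : 0 ≤ ε) (h1 : ε ≤ 1) :
    Tendsto (fun n : ℕ => erasureAvg ε (Finset.Ico 0 (n : ℤ)) H / n) atTop
      (𝓝 ((1 - ε) * incrementRate H ε)) := by
  have hlim := tendsto_atTop_ciInf (hH.antitone_erasureAvg_past h0 h1)
    (hH.bddBelow_erasureAvg_past h0 h1)
  refine (hlim.const_mul (1 - ε)).cesaro.congr fun n => ?_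
  rw [hH.erasureAvg_Ico_eq_sum, div_eq_inv_mul]

lemma incrementRate_le (hH : IsStationaryEntropy H M) (h0 : 0 ≤ ε) (h1 : ε ≤ 1) (n : ℕ) :
    incrementRate H ε ≤ erasureAvg ε (past n) (increment H) :=
  ciInf_le (hH.bddBelow_erasureAvg_past h0 h1) n

lemma le_incrementRate (hH : IsStationaryEntropy H M) (h0 : 0 ≤ ε) (h1 : ε ≤ 1) {c : ℝ} {N : ℕ}
    (hc : ∀ n, N ≤ n → c ≤ erasureAvg ε (past n) (increment H)) : c ≤ incrementRate H ε :=
  le_ciInf fun n => (hc _ (le_max_left N n)).trans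
    (hH.antitone_erasureAvg_past h0 h1 (le_max_right N n))

end Rate

section Markov

variable {m k : ℕ} {h : ℝ}

lemma Ico_succ_sub (hH : IsStationaryEntropy H M) (a : ℤ) (n : ℕ) :
    H (Finset.Ico a (a + n + 1)) - H (Finset.Ico a (a + n)) = increment H (past n) := by
  rw [increment, ← hH.image_add (insert 0 _) (a + n), ← hH.image_add (past n) (a + n), past]
  congr 2
  · ext x
    simp
    omega
  · ext x
    simp
    omega

lemma Ico_sub_of_markov (hH : IsStationaryEntropy H M)
    (hm : ∀ k, m ≤ k → increment H (past k) = h) {a b c : ℤ} (hab : a + m ≤ b) (hbc : b ≤ c) :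
    H (Finset.Ico a c) - H (Finset.Ico a b) = (c - b : ℤ) * h := by
  induction c, hbc using Int.leInduction with
  | base => simp
  | succ c hbc ih =>
    have hstep := hH.Ico_succ_sub a (c - a).toNat
    rw [hm _ (by omega), Int.toNat_of_nonneg (by omega), add_sub_cancel] at hstep
    push_cast at ih ⊢
    linarith

/-- The `m` symbols before an erased symbol screen off the earlier past. -/
lemma increment_erase_of_markov (hH : IsStationaryEntropy H M)
    (hm : ∀ k, m ≤ k → increment H (past k) = h) {j : ℤ} (hj : j < 0) (hk : -(k : ℤ) ≤ j - m) :
    increment H ((past k).erase j) =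
      increment H (Finset.Ico (j + 1) 0 ∪ Finset.Ico (j - m) j) := by
  have union_Ico {a : ℤ} (ha : a ≤ j) :
      Finset.Ico j 1 ∪ Finset.Ico a j = Finset.Ico a 1 := by
    rw [Finset.union_comm, Finset.Ico_union_Ico_eq_Ico ha (by omega)]
  have hfuture : H (Finset.Ico j 1 ∪ Finset.Ico (-(k : ℤ)) j) - H (Finset.Ico (-(k : ℤ)) j) =
      H (Finset.Ico j 1 ∪ Finset.Ico (j - m) j) - H (Finset.Ico (j - m) j) := by
    rw [union_Ico (by omega), union_Ico (by omega),
      hH.Ico_sub_of_markov hm (by omega) (by omega), hH.Ico_sub_of_markov hm (by omega) (by omega)]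
  have hscreen {C : Finset ℤ} (hC : C ⊆ Finset.Ico j 1) :=
    hH.union_sub_eq_of_union_sub_eq (Finset.Ico_subset_Ico_left hk) hC hfuture
  have hpresent := hscreen (Finset.Ico_subset_Ico (b₁ := 1) (by omega : j ≤ j + 1) le_rfl)
  have hpast := hscreen (Finset.Ico_subset_Ico (by omega : j ≤ j + 1) zero_le_one)
  have erase_past : (past k).erase j = Finset.Ico (j + 1) 0 ∪ Finset.Ico (-(k : ℤ)) j := by
    ext x
    simp only [Finset.mem_erase, mem_past, Finset.mem_union, Finset.mem_Ico]
    omega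
  have insert_zero (s : Finset ℤ) :
      insert 0 (Finset.Ico (j + 1) 0 ∪ s) = Finset.Ico (j + 1) 1 ∪ s := by
    rw [← Finset.insert_union, Finset.insert_Ico_right_eq_Ico_add_one (by omega), zero_add]
  rw [erase_past, increment, increment, insert_zero, insert_zero]
  linarith

lemma increment_erase_of_lt (hH : IsStationaryEntropy H M)
    (hm : ∀ k, m ≤ k → increment H (past k) = h) {j : ℤ} (hj : j < -(m : ℤ)) (hk : m ≤ k) :
    increment H ((past k).erase j) = h := by
  refine le_antisymm ?_ ?_
  · rw [← hm m le_rfl]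
    refine hH.antitone_increment fun x hx => ?_
    simp only [Finset.mem_erase, mem_past] at hx ⊢
    omega
  · rw [← hm k hk]
    exact hH.antitone_increment (Finset.erase_subset _ _)

lemma increment_erase_eq (hH : IsStationaryEntropy H M)
    (hm : ∀ k, m ≤ k → increment H (past k) = h) {j : ℤ} (hj : j ∈ past (2 * m))
    (hk : 2 * m ≤ k) :
    increment H ((past k).erase j) = increment H ((past (2 * m)).erase j) := by
  rw [mem_past] at hj
  rcases lt_or_ge j (-(m : ℤ)) with hjm | hjm
  · rw [hH.increment_erase_of_lt hm hjm (by omega), hH.increment_erase_of_lt hm hjm (by omega)]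
  · rw [hH.increment_erase_of_markov hm hj.2 (by omega),
      hH.increment_erase_of_markov hm hj.2 (by omega)]

lemma sum_increment_erase_of_markov (hH : IsStationaryEntropy H M)
    (hm : ∀ k, m ≤ k → increment H (past k) = h) :
    ∑ j ∈ past m, increment H ((past (2 * m)).erase j) =
      ∑ i ∈ Finset.Icc 1 m, increment H
        (Finset.Icc (-(i : ℤ) + 1) (-1) ∪ Finset.Icc (-(i : ℤ) - m) (-(i : ℤ) - 1)) := by
  refine (Finset.sum_bij (fun (i : ℕ) _ => -(i : ℤ)) ?_ ?_ ?_ ?_).symm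
  · intro i hi
    rw [Finset.mem_Icc] at hi
    rw [mem_past]
    omega
  · intro i _ j _ hij
    simpa using hij
  · intro j hj
    rw [mem_past] at hj
    exact ⟨(-j).toNat, by rw [Finset.mem_Icc]; omega, by omega⟩
  · intro i hi
    rw [Finset.mem_Icc] at hi
    rw [hH.increment_erase_of_markov hm (by omega) (by omega), ← Finset.Icc_sub_one_right_eq_Ico,
      ← Finset.Icc_sub_one_right_eq_Ico, zero_sub]

lemma erasureSlope_of_markov (hH : IsStationaryEntropy H M)
    (hm : ∀ k, m ≤ k → increment H (past k) = h) :
    erasureSlope (past (2 * m)) (increment H) =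
      -((m + 1) * increment H (Finset.Icc (-(m : ℤ)) (-1)) -
        ∑ i ∈ Finset.Icc 1 m, increment H
          (Finset.Icc (-(i : ℤ) + 1) (-1) ∪ Finset.Icc (-(i : ℤ) - m) (-(i : ℤ) - 1))) := by
  have sum_early : ∑ j ∈ Finset.Ico (-((2 * m : ℕ) : ℤ)) (-m),
      increment H ((past (2 * m)).erase j) = m * h := by
    rw [Finset.sum_congr rfl fun j hj =>
        hH.increment_erase_of_lt hm (Finset.mem_Ico.1 hj).2 (by omega),
      Finset.sum_const, nsmul_eq_mul, Int.card_Ico]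
    congr 2
    omega
  have sum_past (f : ℤ → ℝ) : ∑ j ∈ past (2 * m), f j =
      ∑ j ∈ Finset.Ico (-((2 * m : ℕ) : ℤ)) (-m), f j + ∑ j ∈ past m, f j := by
    rw [past, past, ← Finset.sum_union (Finset.Ico_disjoint_Ico_consecutive _ _ _),
      Finset.Ico_union_Ico_eq_Ico (by omega) (by omega)]
  have Icc_eq_past : Finset.Icc (-(m : ℤ)) (-1) = past m := by
    rw [past, ← Finset.Icc_sub_one_right_eq_Ico, zero_sub]
  rw [erasureSlope, sum_past, sum_early, hH.sum_increment_erase_of_markov hm, hm _ (by omega),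
    Icc_eq_past, hm m le_rfl, card_past]
  push_cast
  ring

/-- By antitonicity the earlier past may be revealed at no cost in a lower bound, so that only
the erasures among the last `2 * m` symbols need to be expanded. -/
lemma le_erasureAvg_of_markov (hH : IsStationaryEntropy H M)
    (hm : ∀ k, m ≤ k → increment H (past k) = h) {ε : ℝ} (h0 : 0 ≤ ε) (h1 : ε ≤ 1)
    (hk : 2 * m ≤ k) :
    h + ε * erasureSlope (past (2 * m)) (increment H) -
        2 * (2 * m : ℕ) * ((2 * m : ℕ) + 1) * M * ε ^ 2 ≤
      (1 - ε) * erasureAvg ε (past k) (increment H) := by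
  set recent := past (2 * m)
  set early := Finset.Ico (-(k : ℤ)) (-((2 * m : ℕ) : ℤ))
  have past_eq : past k = recent ∪ early := by
    rw [Finset.union_comm]
    exact (Finset.Ico_union_Ico_eq_Ico (by omega) (by omega)).symm
  have hdisj : Disjoint recent early := (Finset.Ico_disjoint_Ico_consecutive _ _ _).symm
  have slope_eq : erasureSlope recent (fun D => increment H (D ∪ early)) =
      erasureSlope recent (increment H) := by
    rw [erasureSlope, erasureSlope, ← past_eq, hm k (by omega), hm (2 * m) (by omega)]
    congr 1
    refine Finset.sum_congr rfl fun j hj => ?_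
    rw [← hH.increment_erase_eq hm hj hk, past_eq, Finset.erase_union_distrib,
      Finset.erase_eq_of_notMem (Finset.disjoint_left.1 hdisj hj)]
  have expansion := abs_one_sub_mul_erasureAvg_sub_le h0 h1 (s := recent)
    (f := fun D => increment H (D ∪ early)) fun D _ => hH.abs_increment_le _
  rw [slope_eq, ← past_eq, hm k (by omega), card_past] at expansion
  have reveal := mul_le_mul_of_nonneg_left
    (le_erasureAvg_union h0 h1 hH.antitone_increment hdisj) (sub_nonneg.2 h1)
  rw [past_eq]
  linarith [(abs_le.1 expansion).1]

end Markov

end IsStationaryEntropy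

section RevealedNoise

variable {Ω Ω' α β γ : Type*} [MeasurableSpace Ω] [MeasurableSpace Ω'] {μ : Measure Ω}
  {ν : Measure Ω'}

lemma entropy_comp_eq_sum [IsFiniteMeasure μ] [Fintype α] [MeasurableSpace α]
    [MeasurableSingletonClass α] [Fintype γ] {X : Ω → α} (hX : Measurable X) (f : α → γ) :
    entropy μ (fun x => f (X x)) =
      ∑ a, μ.real (X ⁻¹' {a}) * -Real.log (μ.real ((fun x => f (X x)) ⁻¹' {f a})) := by
  classical
  rw [← Finset.sum_fiberwise _ f, entropy]
  refine Finset.sum_congr rfl fun c _ => ?_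
  rw [Real.negMulLog, neg_mul, ← mul_neg]
  nth_rw 1 [measureReal_comp_preimage_singleton hX]
  rw [Finset.sum_mul]
  refine Finset.sum_congr rfl fun a ha => ?_
  rw [(Finset.mem_filter.1 ha).2]

variable [SFinite ν] (X : Ω → α) (E : Ω' → β) {g : α → β → γ}

lemma measureReal_prod_input_inter_output (hg : ∀ a a' b b', g a b = g a' b' → b = b')
    (a : α) (b : β) :
    (μ.prod ν).real ((fun p => X p.1) ⁻¹' {a} ∩ (fun p => g (X p.1) (E p.2)) ⁻¹' {g a b}) =
      μ.real (X ⁻¹' {a}) * ν.real (E ⁻¹' {b}) := by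
  rw [← measureReal_prod_prod]
  congr 1
  ext p
  simp only [Set.mem_inter_iff, Set.mem_preimage, Set.mem_singleton_iff, Set.mem_prod]
  constructor
  · rintro ⟨ha, hb⟩
    exact ⟨ha, hg _ _ _ _ hb⟩
  · rintro ⟨ha, hb⟩
    exact ⟨ha, by rw [ha, hb]⟩

lemma measureReal_prod_output (hg : ∀ a a' b b', g a b = g a' b' → b = b') (a : α) (b : β) :
    (μ.prod ν).real ((fun p => g (X p.1) (E p.2)) ⁻¹' {g a b}) =
      μ.real ((fun x => g (X x) b) ⁻¹' {g a b}) * ν.real (E ⁻¹' {b}) := by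
  rw [← measureReal_prod_prod]
  congr 1
  ext p
  simp only [Set.mem_preimage, Set.mem_singleton_iff, Set.mem_prod]
  constructor
  · intro h
    have hb := hg _ _ _ _ h
    exact ⟨hb ▸ h, hb⟩
  · rintro ⟨h, hb⟩
    rwa [hb]

variable {X} [IsFiniteMeasure μ] [IsProbabilityMeasure ν] [Fintype α] [Fintype β] [Fintype γ]
  [MeasurableSpace α] [MeasurableSingletonClass α]

lemma mutualInfo_prod_eq_sum_entropy (hX : Measurable X)
    (hg : ∀ a a' b b', g a b = g a' b' → b = b') :
    mutualInfo (μ.prod ν) (fun p => X p.1) (fun p => g (X p.1) (E p.2)) =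
      ∑ b, ν.real (E ⁻¹' {b}) * entropy μ (fun x => g (X x) b) := by
  have input (a : α) : (μ.prod ν).real ((fun p => X p.1) ⁻¹' {a}) = μ.real (X ⁻¹' {a}) := by
    have h := measureReal_prod_prod (μ := μ) (ν := ν) (X ⁻¹' {a}) Set.univ
    rwa [Set.prod_univ, probReal_univ, mul_one] at h
  have outputEntropy (b : β) : entropy μ (fun x => g (X x) b) =
      ∑ a, μ.real (X ⁻¹' {a}) * -Real.log (μ.real ((fun x => g (X x) b) ⁻¹' {g a b})) :=
    entropy_comp_eq_sum hX (g · b)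
  simp only [outputEntropy, Finset.mul_sum]
  rw [mutualInfo]
  conv_rhs => rw [Finset.sum_comm]
  refine Finset.sum_congr rfl fun a _ => ?_
  have hinj : Function.Injective (g a) := fun b b' => hg a a b b'
  refine (Fintype.sum_of_injective (g a) hinj _ _ (fun c hc => ?_) fun b => ?_).symm
  · have : (fun p : Ω × Ω' => X p.1) ⁻¹' {a} ∩ (fun p => g (X p.1) (E p.2)) ⁻¹' {c} = ∅ := by
      refine Set.eq_empty_of_forall_notMem ?_
      rintro p ⟨rfl, rfl⟩
      exact hc ⟨_, rfl⟩
    rw [this, measureReal_empty, zero_mul]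
  · rw [measureReal_prod_input_inter_output X E hg, input, measureReal_prod_output X E hg]
    by_cases ha : μ.real (X ⁻¹' {a}) = 0
    · simp [ha]
    by_cases hb : ν.real (E ⁻¹' {b}) = 0
    · simp [hb]
    rw [mul_div_mul_left _ _ ha, div_mul_cancel_right₀ hb, Real.log_inv]
    ring

end RevealedNoise

section Erasure

/-- The family `x` with all coordinates outside `D` erased. -/
def mask {κ α : Type*} [DecidableEq κ] (x : κ → α) (D : Finset κ) (k : κ) : Option α :=
  if k ∈ D then some (x k) else none

lemma mask_eq_mask_iff {κ α : Type*} [DecidableEq κ] {x y : κ → α} {D E : Finset κ} :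
    mask x D = mask y E ↔ D = E ∧ ∀ k ∈ D, x k = y k := by
  constructor
  · intro h
    have hmask (k : κ) := congrFun h k
    simp only [mask] at hmask
    exact ⟨by ext k; grind, fun k hk => by grind⟩
  · rintro ⟨rfl, h⟩
    ext1 k
    simp only [mask]
    split_ifs with hk
    · rw [h k hk]
    · rfl

instance (ε : I) : IsProbabilityMeasure (erasureLaw ε) := by
  unfold erasureLaw
  infer_instance

lemma erasureLaw_real_eq_of_subset (ε : I) {s D : Finset ℤ} (hD : D ⊆ s) :
    (erasureLaw ε).real {e | ∀ i ∈ s, e i = decide (i ∈ D)} =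
      (1 - (ε : ℝ)) ^ D.card * (ε : ℝ) ^ (s.card - D.card) := by
  have cylinder : {e : ℤ → Bool | ∀ i ∈ s, e i = decide (i ∈ D)} =
      Set.pi s fun i => {decide (i ∈ D)} := rfl
  have symbol (i : ℤ) : (bernoulliMeasure false true ε).real {decide (i ∈ D)} =
      if i ∈ D then 1 - (ε : ℝ) else ε := by
    rw [bernoulliMeasure_real_apply _ (measurableSet_singleton _)]
    by_cases h : i ∈ D <;> simp [h]
  rw [cylinder, erasureLaw, measureReal_def,
    Measure.infinitePi_pi _ fun _ _ => measurableSet_singleton _, ENNReal.toReal_prod]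
  simp only [← measureReal_def, symbol]
  rw [Finset.prod_ite, Finset.prod_const, Finset.prod_const, Finset.filter_mem_eq_inter,
    Finset.inter_eq_right.2 hD, Finset.filter_notMem_eq_sdiff, Finset.card_sdiff_of_subset hD]

variable {K : ℕ}

lemma mutualInfo_output_eq_erasureAvg {κ : Type*} [Fintype κ] [DecidableEq κ]
    (μ : Measure (ℤ → Fin K)) [IsFiniteMeasure μ] (ε : I) {c : κ → ℤ}
    (hc : Function.Injective c) :
    mutualInfo (μ.prod (erasureLaw ε)) (fun p k => p.1 (c k)) (fun p k => output p (c k)) =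
      erasureAvg ε (Finset.univ.image c) (blockEntropy μ) := by
  have output_eq_mask : (fun (p : (ℤ → Fin K) × (ℤ → Bool)) k => output p (c k)) =
      fun p => mask (fun k => p.1 (c k)) {k | p.2 (c k) = true} := by
    ext1 p
    ext1 k
    simp [output, mask]
  have pattern (D : Finset κ) :
      (erasureLaw ε).real ((fun e => ({k | e (c k) = true} : Finset κ)) ⁻¹' {D}) =
        (1 - (ε : ℝ)) ^ D.card * (ε : ℝ) ^ ((Finset.univ : Finset κ).card - D.card) := by
    have h := erasureLaw_real_eq_of_subset ε (Finset.image_subset_image (f := c) D.subset_univ)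
    rw [Finset.card_image_of_injective _ hc, Finset.card_image_of_injective _ hc] at h
    rw [← h]
    congr 1
    ext e
    simp only [Set.mem_preimage, Set.mem_singleton_iff, Finset.ext_iff, Finset.mem_filter_univ,
      Set.mem_ofPred_eq, Finset.forall_mem_image, Finset.mem_univ, forall_const,
      hc.mem_finset_image]
    exact forall_congr' fun k => by grind
  have masked (D : Finset κ) :
      entropy μ (fun x => mask (fun k => x (c k)) D) = blockEntropy μ (D.image c) := by
    refine entropy_congr fun x y => ?_
    rw [mask_eq_mask_iff, restrict_eq_iff]
    simp
  rw [output_eq_mask, mutualInfo_prod_eq_sum_entropy (X := fun x : ℤ → Fin K => fun k => x (c k))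
    (fun e : ℤ → Bool => ({k | e (c k) = true} : Finset κ)) (g := mask) (by fun_prop)
    fun _ _ _ _ h => (mask_eq_mask_iff.1 h).1, erasureAvg_image _ _ hc, erasureAvg,
    Finset.powerset_univ]
  exact Finset.sum_congr rfl fun D _ => by rw [pattern, masked]

lemma image_natCast_univ (n : ℕ) :
    (Finset.univ.image fun k : Fin n => (k : ℤ)) = Finset.Ico 0 (n : ℤ) := by
  ext i
  simp only [Finset.mem_image, Finset.mem_univ, true_and, Finset.mem_Ico]
  constructor
  · rintro ⟨k, rfl⟩
    omega
  · intro hi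
    exact ⟨⟨i.toNat, by omega⟩, Int.toNat_of_nonneg hi.1⟩

lemma natCast_fin_injective (n : ℕ) : Function.Injective fun k : Fin n => (k : ℤ) :=
  Nat.cast_injective.comp Fin.val_injective

lemma blockEntropy_Ico (μ : Measure (ℤ → Fin K)) (n : ℕ) :
    blockEntropy μ (Finset.Ico 0 (n : ℤ)) = entropy μ (fun x (k : Fin n) => x (k : ℤ)) := by
  rw [← image_natCast_univ]
  refine entropy_congr fun x y => ?_
  simp [funext_iff]

variable {μ : Measure (ℤ → Fin K)}

lemma IsStationaryLaw.mutualInfoRate_eq (hμ : IsStationaryLaw μ) (ε : I) :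
    mutualInfoRate μ ε = (1 - ε) * incrementRate (blockEntropy μ) ε := by
  have := hμ.isProbabilityMeasure
  rw [mutualInfoRate]
  simp only [mutualInfo_output_eq_erasureAvg μ ε (natCast_fin_injective _), image_natCast_univ]
  exact (hμ.isStationaryEntropy.tendsto_erasureAvg_div ε.2.1 ε.2.2).limUnder_eq

lemma mutualInfoRate_zero (μ : Measure (ℤ → Fin K)) [IsFiniteMeasure μ] :
    mutualInfoRate μ 0 = entropyRate μ := by
  rw [mutualInfoRate, entropyRate]
  simp only [mutualInfo_output_eq_erasureAvg μ 0 (natCast_fin_injective _), image_natCast_univ,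
    Set.Icc.coe_zero, erasureAvg_zero, blockEntropy_Ico]

lemma IsStationaryLaw.entropyRate_eq_incrementRate (hμ : IsStationaryLaw μ) :
    entropyRate μ = incrementRate (blockEntropy μ) 0 := by
  have := hμ.isProbabilityMeasure
  rw [← mutualInfoRate_zero, hμ.mutualInfoRate_eq, Set.Icc.coe_zero, sub_zero, one_mul]

end Erasure

section Words

variable {K : ℕ}

lemma wordAt_succ (x : ℤ → Fin K) (i : ℤ) (l : ℕ) :
    wordAt x i (l + 1) = x i :: wordAt x (i + 1) l := by
  simp only [wordAt, List.ofFn_succ, Fin.val_zero, Nat.cast_zero, add_zero, Fin.val_succ,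
    Nat.cast_add, Nat.cast_one, add_comm, add_left_comm]

lemma wordAt_succ_last (x : ℤ → Fin K) (i : ℤ) (l : ℕ) :
    wordAt x i (l + 1) = wordAt x i l ++ [x (i + l)] := by
  rw [wordAt, List.ofFn_succ', List.concat_eq_append]
  simp [wordAt]

/-- The event that the word `w` occurs at time `i`. -/
def wordEvent (i : ℤ) (w : List (Fin K)) : Set (ℤ → Fin K) := {x | wordAt x i w.length = w}

lemma mem_wordEvent {i : ℤ} {w : List (Fin K)} {x : ℤ → Fin K} :
    x ∈ wordEvent i w ↔ wordAt x i w.length = w := Iff.rfl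

lemma wordEvent_nil (i : ℤ) : wordEvent i ([] : List (Fin K)) = Set.univ := by
  ext x
  simp [mem_wordEvent, wordAt]

lemma mem_wordEvent_cons {i : ℤ} {a : Fin K} {w : List (Fin K)} {x : ℤ → Fin K} :
    x ∈ wordEvent i (a :: w) ↔ x i = a ∧ x ∈ wordEvent (i + 1) w := by
  rw [mem_wordEvent, List.length_cons, wordAt_succ, List.cons.injEq, mem_wordEvent]

lemma mem_wordEvent_concat {i : ℤ} {b : Fin K} {w : List (Fin K)} {x : ℤ → Fin K} :
    x ∈ wordEvent i (w ++ [b]) ↔ x ∈ wordEvent i w ∧ x (i + w.length) = b := by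
  rw [mem_wordEvent, List.length_append, List.length_singleton, wordAt_succ_last, mem_wordEvent,
    List.append_singleton_inj]

lemma shift_mem_wordEvent {i : ℤ} {w : List (Fin K)} {x : ℤ → Fin K} :
    shift x ∈ wordEvent i w ↔ x ∈ wordEvent (i + 1) w := by
  simp only [mem_wordEvent, wordAt, shift, add_right_comm]

/-- The letters at the times `i, …, i + l - 1`, as a tuple. -/
def window (i : ℤ) (l : ℕ) (x : ℤ → Fin K) (k : Fin l) : Fin K := x (i + (k : ℤ))

lemma continuous_window (i : ℤ) (l : ℕ) : Continuous (window (K := K) i l) :=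
  continuous_pi fun _ => continuous_apply _

lemma window_surjective [NeZero K] (i : ℤ) (l : ℕ) : Function.Surjective (window (K := K) i l) :=
  Function.Injective.surjective_comp_right
    ((add_right_injective i).comp (natCast_fin_injective l))

lemma exists_restrict_eq_comp_window {i : ℤ} {l : ℕ} {D : Finset ℤ}
    (hD : D ⊆ Finset.Ico i (i + l)) : ∃ g : (Fin l → Fin K) → D → Fin K,
      ∀ x : ℤ → Fin K, (fun d : D => x d) = g (window i l x) := by
  have bounds (d : D) : i ≤ d ∧ (d : ℤ) < i + l := Finset.mem_Ico.1 (hD d.2)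
  refine ⟨fun z d => z ⟨((d : ℤ) - i).toNat, by have := bounds d; omega⟩,
    fun x => funext fun d => congrArg x ?_⟩
  have := bounds d
  push_cast
  omega

lemma window_preimage_singleton (i : ℤ) {l : ℕ} (z : Fin l → Fin K) :
    window i l ⁻¹' {z} = wordEvent i (List.ofFn z) := by
  ext x
  rw [mem_wordEvent, wordAt, List.length_ofFn, List.ofFn_inj]
  rfl

lemma exists_ofFn_eq {α : Type*} {n : ℕ} {w : List α} (h : w.length = n) :
    ∃ z : Fin n → α, List.ofFn z = w := by
  subst h
  exact ⟨w.get, List.ofFn_get w⟩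

lemma isClopen_wordEvent (i : ℤ) (w : List (Fin K)) : IsClopen (wordEvent i w) := by
  obtain ⟨n, z, rfl⟩ : ∃ n, ∃ z : Fin n → Fin K, List.ofFn z = w := ⟨_, exists_ofFn_eq rfl⟩
  rw [← window_preimage_singleton]
  exact (isClopen_discrete _).preimage (continuous_window i _)

lemma measurableSet_wordEvent (i : ℤ) (w : List (Fin K)) : MeasurableSet (wordEvent i w) :=
  (isClopen_wordEvent i w).isOpen.measurableSet

lemma sum_measureReal_wordEvent_concat (μ : Measure (ℤ → Fin K)) [IsFiniteMeasure μ] (i : ℤ)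
    (w : List (Fin K)) : ∑ b, μ.real (wordEvent i (w ++ [b])) = μ.real (wordEvent i w) := by
  rw [← sum_measureReal_inter_preimage_singleton _ (measurable_pi_apply (i + w.length))]
  refine Finset.sum_congr rfl fun b _ => congrArg _ (Set.ext fun x => ?_)
  exact mem_wordEvent_concat

lemma sum_measureReal_wordEvent_cons (μ : Measure (ℤ → Fin K)) [IsFiniteMeasure μ] (i : ℤ)
    (w : List (Fin K)) : ∑ a, μ.real (wordEvent i (a :: w)) = μ.real (wordEvent (i + 1) w) := by
  rw [← sum_measureReal_inter_preimage_singleton _ (measurable_pi_apply i)]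
  refine Finset.sum_congr rfl fun b _ => congrArg _ (Set.ext fun x => ?_)
  exact mem_wordEvent_cons.trans and_comm

lemma measure_ext_of_wordEvent {μ ν : Measure (ℤ → Fin K)} [IsFiniteMeasure μ] (m : ℕ)
    (h : ∀ i w, m ≤ w.length → μ (wordEvent i w) = ν (wordEvent i w)) : μ = ν := by
  have map_window (i : ℤ) {l : ℕ} (hl : m ≤ l) : μ.map (window i l) = ν.map (window i l) := by
    refine Measure.ext_of_singleton fun z => ?_
    simp only [Measure.map_apply (continuous_window i l).measurable (measurableSet_singleton z),
      window_preimage_singleton]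
    exact h _ _ (by simpa using hl)
  refine IsProjectiveLimit.unique (P := fun J : Finset ℤ => μ.map J.restrict) (fun _ => rfl)
    fun J => ?_
  change ν.map J.restrict = μ.map J.restrict
  set R : ℕ := J.sup Int.natAbs + m + 1
  have hJ : J ⊆ Finset.Ico (-(R : ℤ)) (-(R : ℤ) + (2 * R : ℕ)) := fun d hd => by
    have := Finset.le_sup (f := Int.natAbs) hd
    rw [Finset.mem_Ico]
    omega
  obtain ⟨g, hg⟩ := exists_restrict_eq_comp_window (K := K) hJ
  have restrict_eq : J.restrict = g ∘ window (-(R : ℤ)) (2 * R) := funext hg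
  rw [restrict_eq, ← Measure.map_map .of_discrete (continuous_window _ _).measurable,
    ← Measure.map_map .of_discrete (continuous_window _ _).measurable, ← map_window _ (by omega)]

end Words

section WordSum

variable {α : Type*} [Fintype α] {n : ℕ} {f g : List α → ℝ}

/-- The sum of `f` over all words of length `n`. -/
noncomputable def wordSum (n : ℕ) (f : List α → ℝ) : ℝ :=
  ∑ z : Fin n → α, f (List.ofFn z)

lemma wordSum_zero (f : List α → ℝ) : wordSum 0 f = f [] := by
  simp [wordSum]

lemma wordSum_succ (n : ℕ) (f : List α → ℝ) :
    wordSum (n + 1) f = wordSum n fun w => ∑ a, f (a :: w) := by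
  rw [wordSum, ← (Fin.consEquiv fun _ => α).sum_comp, Fintype.sum_prod_type, Finset.sum_comm]
  simp [wordSum, Fin.consEquiv, List.ofFn_succ]

lemma wordSum_succ_last (n : ℕ) (f : List α → ℝ) :
    wordSum (n + 1) f = wordSum n fun w => ∑ b, f (w ++ [b]) := by
  rw [wordSum, ← (Fin.snocEquiv fun _ => α).sum_comp, Fintype.sum_prod_type, Finset.sum_comm]
  simp only [wordSum, Fin.snocEquiv, Equiv.coe_fn_mk, List.ofFn_succ', Fin.snoc_castSucc,
    Fin.snoc_last, List.concat_eq_append]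

lemma wordSum_congr (h : ∀ w, w.length = n → f w = g w) : wordSum n f = wordSum n g :=
  Finset.sum_congr rfl fun _ _ => h _ List.length_ofFn

lemma wordSum_const_mul (n : ℕ) (c : ℝ) (f : List α → ℝ) :
    wordSum n (fun w => c * f w) = c * wordSum n f :=
  (Finset.mul_sum _ _ _).symm

lemma le_wordSum (h : ∀ w, w.length = n → 0 ≤ f w) {w : List α} (hw : w.length = n) :
    f w ≤ wordSum n f := by
  obtain ⟨z, rfl⟩ := exists_ofFn_eq hw
  exact Finset.single_le_sum (f := fun z : Fin n → α => f (List.ofFn z))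
    (fun z _ => h _ List.length_ofFn) (Finset.mem_univ z)

end WordSum

section WordProb

variable {K : ℕ}

/-- The probability that the word `w` occurs at time `0`. -/
noncomputable def wordProb (μ : Measure (ℤ → Fin K)) (w : List (Fin K)) : ℝ :=
  μ.real (wordEvent 0 w)

lemma wordProb_nonneg (μ : Measure (ℤ → Fin K)) (w : List (Fin K)) : 0 ≤ wordProb μ w :=
  measureReal_nonneg

namespace IsStationaryLaw

variable {μ : Measure (ℤ → Fin K)} (hμ : IsStationaryLaw μ)

include hμ

lemma measureReal_wordEvent (i : ℤ) (w : List (Fin K)) :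
    μ.real (wordEvent i w) = wordProb μ w := by
  have succ (i : ℤ) : μ.real (wordEvent (i + 1) w) = μ.real (wordEvent i w) := by
    rw [← hμ.measurePreserving.measureReal_preimage
      (measurableSet_wordEvent i w).nullMeasurableSet]
    exact congrArg _ (Set.ext fun x => shift_mem_wordEvent.symm)
  induction i using Int.induction_on with
  | zero => rfl
  | succ i ih => rw [succ, ih]
  | pred i ih => rw [← ih, ← succ, sub_add_cancel]

lemma sum_wordProb_concat (w : List (Fin K)) : ∑ b, wordProb μ (w ++ [b]) = wordProb μ w := by
  have := hμ.isProbabilityMeasure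
  exact sum_measureReal_wordEvent_concat μ 0 w

lemma sum_wordProb_cons (w : List (Fin K)) : ∑ a, wordProb μ (a :: w) = wordProb μ w := by
  have := hμ.isProbabilityMeasure
  rw [← hμ.measureReal_wordEvent (0 + 1)]
  exact sum_measureReal_wordEvent_cons μ 0 w

lemma wordProb_nil : wordProb μ [] = 1 := by
  have := hμ.isProbabilityMeasure
  simp [wordProb, wordEvent_nil]

lemma wordSum_wordProb (n : ℕ) : wordSum n (wordProb μ) = 1 := by
  induction n with
  | zero => rw [wordSum_zero, hμ.wordProb_nil]
  | succ n ih =>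
    rw [wordSum_succ_last, ← ih]
    exact wordSum_congr fun w _ => hμ.sum_wordProb_concat w

lemma mem_allowedWords {w : List (Fin K)} : w ∈ allowedWords μ ↔ 0 < wordProb μ w := by
  have := hμ.isProbabilityMeasure
  have pos_iff (i : ℤ) : 0 < μ (wordEvent i w) ↔ 0 < wordProb μ w := by
    rw [← hμ.measureReal_wordEvent i w, measureReal_def, ENNReal.toReal_pos_iff,
      and_iff_left (measure_lt_top _ _)]
  exact (exists_congr pos_iff).trans (exists_const ℤ)

lemma wordProb_eq_zero_of_notMem {w : List (Fin K)} (hw : w ∉ allowedWords μ) :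
    wordProb μ w = 0 :=
  le_antisymm (not_lt.1 (hμ.mem_allowedWords.not.1 hw)) (wordProb_nonneg μ w)

lemma increment_past (n : ℕ) : increment (blockEntropy μ) (past n) =
    wordSum (n + 1) (fun w => Real.negMulLog (wordProb μ w)) -
      wordSum n (fun w => Real.negMulLog (wordProb μ w)) := by
  have blockEntropy_eq (n : ℕ) : blockEntropy μ (Finset.Ico 0 (n : ℤ)) =
      wordSum n (fun w => Real.negMulLog (wordProb μ w)) := by
    rw [blockEntropy_Ico, entropy, wordSum]
    refine Finset.sum_congr rfl fun z _ => ?_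
    rw [wordProb, ← window_preimage_singleton]
    congr 3
    ext x k
    simp [window]
  rw [← blockEntropy_eq, ← blockEntropy_eq, ← hμ.isStationaryEntropy.Ico_succ_sub 0 n]
  simp

end IsStationaryLaw

end WordProb

section Consistent

/-- A family of word probabilities that is consistent under both one-sided extensions, for words
of length at least `m`: the family of word probabilities that determines a stationary law. -/
structure IsConsistent {α : Type*} [Fintype α] (m : ℕ) (P : List α → ℝ) : Prop where
  nonneg : ∀ w, 0 ≤ P w
  sum_concat : ∀ w, m ≤ w.length → ∑ b, P (w ++ [b]) = P w
  sum_cons : ∀ w, m ≤ w.length → ∑ a, P (a :: w) = P w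
  wordSum_eq_one : wordSum m P = 1

namespace IsConsistent

lemma wordSum_of_le {α : Type*} [Fintype α] {m : ℕ} {P : List α → ℝ} (hP : IsConsistent m P)
    {n : ℕ} (hn : m ≤ n) : wordSum n P = 1 := by
  induction n, hn using Nat.le_induction with
  | base => exact hP.wordSum_eq_one
  | succ n hn ih =>
    rw [wordSum_succ_last, ← ih]
    exact wordSum_congr fun w hw => hP.sum_concat w (by omega)

variable {K m : ℕ} {P : List (Fin K) → ℝ} (hP : IsConsistent m P)

include hP

lemma measureReal_wordEvent_of_length_eq {μ : Measure (ℤ → Fin K)} [IsFiniteMeasure μ] {i : ℤ}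
    {n : ℕ} (h : ∀ w, w.length = n → μ.real (wordEvent i w) = P w) {j : ℤ} {w : List (Fin K)}
    (hw : m ≤ w.length) (hij : i ≤ j) (hjn : j + w.length ≤ i + n) :
    μ.real (wordEvent j w) = P w := by
  obtain ⟨c, rfl⟩ := Int.le.dest hij
  obtain ⟨d, hd⟩ : ∃ d, n = c + w.length + d := Nat.exists_eq_add_of_le (by omega)
  clear hij hjn
  induction c generalizing d w with
  | zero =>
    induction d generalizing w with
    | zero => simpa using h w (by omega)
    | succ d ih =>
      rw [← sum_measureReal_wordEvent_concat, ← hP.sum_concat w hw]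
      exact Finset.sum_congr rfl fun b _ => ih (by simp; omega) (by simp; omega)
  | succ c ih =>
    push_cast
    rw [← add_assoc, ← sum_measureReal_wordEvent_cons, ← hP.sum_cons w hw]
    exact Finset.sum_congr rfl fun a _ => ih (by simp; omega) d (by simp; omega)

lemma exists_probabilityMeasure_of_length_eq [NeZero K] {n : ℕ} (hn : m ≤ n) (i : ℤ) :
    ∃ μ : ProbabilityMeasure (ℤ → Fin K),
      ∀ w, w.length = n → (μ : Measure _).real (wordEvent i w) = P w := by
  let p : PMF (Fin n → Fin K) := PMF.ofFintype (fun z => ENNReal.ofReal (P (List.ofFn z))) <| by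
    rw [← ENNReal.ofReal_sum_of_nonneg fun z _ => hP.nonneg _, ← ENNReal.ofReal_one,
      ← hP.wordSum_of_le hn, wordSum]
  let μ := p.toMeasure.map (Function.surjInv (window_surjective (K := K) i n))
  refine ⟨⟨μ, Measure.isProbabilityMeasure_map (Measurable.of_discrete).aemeasurable⟩,
    fun w hw => ?_⟩
  obtain ⟨z, rfl⟩ := exists_ofFn_eq hw
  rw [ProbabilityMeasure.coe_mk, measureReal_def, ← window_preimage_singleton,
    Measure.map_apply .of_discrete ((continuous_window i n).measurable .of_discrete),
    ← Set.preimage_comp, (Function.rightInverse_surjInv _).comp_eq_id, Set.preimage_id,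
    p.toMeasure_apply_singleton z .of_discrete, PMF.ofFintype_apply,
    ENNReal.toReal_ofReal (hP.nonneg _)]

/- The laws with the prescribed word probabilities inside `[-R, R)` form nonempty closed sets,
decreasing in `R`, of the compact space of probability measures on `ℤ → Fin K`. -/
lemma exists_measure [NeZero K] : ∃ μ : Measure (ℤ → Fin K), IsProbabilityMeasure μ ∧
    ∀ i w, m ≤ w.length → μ.real (wordEvent i w) = P w := by
  let A (R : ℕ) : Set (ProbabilityMeasure (ℤ → Fin K)) := {μ | ∀ i w, m ≤ w.length →
    -(R : ℤ) ≤ i → i + w.length ≤ R → (μ : Measure (ℤ → Fin K)).real (wordEvent i w) = P w}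
  have antitone_A : Antitone A := fun R R' hR μ hμ i w hw h1 h2 =>
    hμ i w hw (by omega) (by omega)
  have nonempty_A (R : ℕ) : (A R).Nonempty := by
    obtain ⟨μ, hμ⟩ := hP.exists_probabilityMeasure_of_length_eq
      (n := 2 * (R + m)) (by omega) (-((R + m : ℕ) : ℤ))
    exact ⟨μ, fun i w hw h1 h2 =>
      hP.measureReal_wordEvent_of_length_eq hμ hw (by omega) (by omega)⟩
  have isClosed_A (R : ℕ) : IsClosed (A R) := by
    simp only [A, Set.ofPred_forall]
    refine isClosed_iInter fun i => isClosed_iInter fun w => isClosed_iInter fun _ =>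
      isClosed_iInter fun _ => isClosed_iInter fun _ => isClosed_eq ?_ continuous_const
    refine continuous_iff_continuousAt.2 fun μ => ?_
    exact (NNReal.continuous_coe.tendsto _).comp
      (ProbabilityMeasure.tendsto_measure_of_isClopen_of_tendsto tendsto_id
        (isClopen_wordEvent i w))
  obtain ⟨μ, hμ⟩ := IsCompact.nonempty_iInter_of_directed_nonempty_isCompact_isClosed A
    antitone_A.directed_ge nonempty_A (fun R => (isClosed_A R).isCompact) isClosed_A
  refine ⟨μ, inferInstance, fun i w hw => ?_⟩
  exact Set.mem_iInter.1 hμ (i.natAbs + w.length) i w hw (by omega) (by omega)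

end IsConsistent

end Consistent

section PerronFrobenius

open Matrix

variable {ι : Type*} [Fintype ι]

lemma mulVec_pos {B : Matrix ι ι ℝ} (hB : ∀ i j, 0 < B i j) {x : ι → ℝ} (hx : 0 ≤ x)
    (hx0 : x ≠ 0) (i : ι) : 0 < (B *ᵥ x) i := by
  obtain ⟨j, hj⟩ := Function.ne_iff.1 hx0
  exact Finset.sum_pos' (fun k _ => mul_nonneg (hB i k).le (hx k))
    ⟨j, Finset.mem_univ j, mul_pos (hB i j) ((hx j).lt_of_ne' hj)⟩

lemma pow_mulVec_eq_of_mulVec_eq [DecidableEq ι] {A : Matrix ι ι ℝ} {c : ℝ} {x : ι → ℝ}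
    (hx : A *ᵥ x = c • x) (k : ℕ) : (A ^ k) *ᵥ x = c ^ k • x := by
  induction k with
  | zero => rw [pow_zero, pow_zero, one_mulVec, one_smul]
  | succ k ih => rw [pow_succ, ← mulVec_mulVec, hx, mulVec_smul, ih, smul_smul, ← pow_succ']

lemma exists_pos_matrix_commute {A : Matrix ι ι ℝ} (hA : A.IsIrreducible) :
    ∃ B : Matrix ι ι ℝ, (∀ i j, 0 < B i j) ∧ Commute A B ∧
      ∀ (c : ℝ) (x : ι → ℝ), A *ᵥ x = c • x → ∃ d : ℝ, B *ᵥ x = d • x := by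
  classical
  choose k _ hk using (isIrreducible_iff_exists_pow_pos hA.nonneg).1 hA
  refine ⟨∑ p : ι × ι, A ^ k p.1 p.2, fun i j => ?_,
    Commute.sum_right _ _ _ fun p _ => Commute.self_pow A _,
    fun c x hx => ⟨∑ p : ι × ι, c ^ k p.1 p.2, ?_⟩⟩
  · rw [Matrix.sum_apply]
    exact Finset.sum_pos' (fun p _ => pow_apply_nonneg hA.nonneg _ i j)
      ⟨(i, j), Finset.mem_univ _, hk i j⟩
  · simp only [sum_mulVec, Finset.sum_smul, pow_mulVec_eq_of_mulVec_eq hx]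

lemma le_sum_of_smul_le_mulVec {A : Matrix ι ι ℝ} (hA : ∀ i j, 0 ≤ A i j) {c : ℝ} {x : ι → ℝ}
    (hx : x ∈ stdSimplex ℝ ι) (h : c • x ≤ A *ᵥ x) : c ≤ ∑ i, ∑ j, A i j :=
  calc c = ∑ i, (c • x) i := by
        simp only [Pi.smul_apply, smul_eq_mul, ← Finset.mul_sum, hx.2, mul_one]
    _ ≤ ∑ i, ∑ j, A i j := Finset.sum_le_sum fun i _ => (h i).trans <|
        Finset.sum_le_sum fun j _ =>
          mul_le_of_le_one_right (hA i j) (mem_Icc_of_mem_stdSimplex hx j).2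

/-- The maximal `c` is the Collatz–Wielandt value of `A`. -/
lemma exists_maximal_smul_le_mulVec [Nonempty ι] {A : Matrix ι ι ℝ} (hA : ∀ i j, 0 ≤ A i j) :
    ∃ c : ℝ, ∃ x ∈ stdSimplex ℝ ι, c • x ≤ A *ᵥ x ∧
      ∀ d : ℝ, ∀ z ∈ stdSimplex ℝ ι, d • z ≤ A *ᵥ z → d ≤ c := by
  classical
  let Z : Set (ℝ × (ι → ℝ)) :=
    (Set.Icc 0 (∑ i, ∑ j, A i j) ×ˢ stdSimplex ℝ ι) ∩ {p | p.1 • p.2 ≤ A *ᵥ p.2}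
  have hZ : IsCompact Z := (isCompact_Icc.prod (isCompact_stdSimplex ℝ ι)).inter_right
    (isClosed_le (by fun_prop) (by fun_prop))
  have hmulVec : ∀ z ∈ stdSimplex ℝ ι, 0 ≤ A *ᵥ z := fun z hz i =>
    Finset.sum_nonneg fun j _ => mul_nonneg (hA i j) (hz.1 j)
  have hZ0 : ∀ z ∈ stdSimplex ℝ ι, ((0 : ℝ), z) ∈ Z := fun z hz =>
    ⟨⟨⟨le_rfl, Finset.sum_nonneg fun i _ => Finset.sum_nonneg fun j _ => hA i j⟩, hz⟩,
      by simpa using hmulVec z hz⟩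
  have hne : Z.Nonempty := ‹Nonempty ι›.elim fun i => ⟨_, hZ0 _ (single_mem_stdSimplex ℝ i)⟩
  obtain ⟨⟨c, x⟩, ⟨⟨-, hx⟩, hcx⟩, hmax⟩ := hZ.exists_isMaxOn hne continuous_fst.continuousOn
  refine ⟨c, x, hx, hcx, fun d z hz hd => ?_⟩
  rcases le_total 0 d with h0 | h0
  · exact hmax (a := (d, z)) ⟨⟨⟨h0, le_sum_of_smul_le_mulVec hA hz hd⟩, hz⟩, hd⟩
  · exact h0.trans (hmax (hZ0 z hz))

lemma exists_pos_smul_le {ι : Type*} [Finite ι] [Nonempty ι] {y z : ι → ℝ} (hy : ∀ i, 0 < y i)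
    (hz : ∀ i, 0 < z i) : ∃ δ : ℝ, 0 < δ ∧ δ • z ≤ y := by
  obtain ⟨i, hi⟩ := Finite.exists_min fun i => y i / z i
  exact ⟨y i / z i, div_pos (hy i) (hz i), fun j => (le_div_iff₀ (hz j)).1 (hi j)⟩

/-- If `A x ≠ c x`, a positive matrix commuting with `A` turns `x` into a vector
witnessing a value larger than `c`. -/
lemma mulVec_eq_smul_of_maximal [Nonempty ι] {A B : Matrix ι ι ℝ} (hB : ∀ i j, 0 < B i j)
    (hAB : Commute A B) {c : ℝ} {x : ι → ℝ} (hx : x ∈ stdSimplex ℝ ι) (hcx : c • x ≤ A *ᵥ x)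
    (hmax : ∀ d : ℝ, ∀ z ∈ stdSimplex ℝ ι, d • z ≤ A *ᵥ z → d ≤ c) : A *ᵥ x = c • x := by
  by_contra hne
  have hx0 : x ≠ 0 := by
    rintro rfl
    simpa using hx.2
  set z := B *ᵥ x with hz
  have hzpos : ∀ i, 0 < z i := mulVec_pos hB hx.1 hx0
  have hAz : A *ᵥ z = c • z + B *ᵥ (A *ᵥ x - c • x) := by
    rw [hz, mulVec_sub, mulVec_smul, add_sub_cancel, mulVec_mulVec, mulVec_mulVec, hAB.eq]
  obtain ⟨δ, hδ, hle⟩ :=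
    exists_pos_smul_le (mulVec_pos hB (sub_nonneg.2 hcx) (sub_ne_zero.2 hne)) hzpos
  have hs : 0 < ∑ i, z i := Finset.sum_pos (fun i _ => hzpos i) Finset.univ_nonempty
  have hsimplex : (∑ i, z i)⁻¹ • z ∈ stdSimplex ℝ ι :=
    ⟨fun i => (mul_pos (inv_pos.2 hs) (hzpos i)).le, by
      simp only [Pi.smul_apply, smul_eq_mul, ← Finset.mul_sum, inv_mul_cancel₀ hs.ne']⟩
  refine (lt_add_of_pos_right c hδ).not_ge (hmax (c + δ) _ hsimplex ?_)
  rw [mulVec_smul, smul_comm]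
  refine smul_le_smul_of_nonneg_left ?_ (inv_pos.2 hs).le
  rw [hAz, add_smul]
  exact add_le_add_right hle _

lemma exists_pos_eigenvector_of_isIrreducible [Nonempty ι] {A : Matrix ι ι ℝ}
    (hA : A.IsIrreducible) : ∃ c : ℝ, ∃ x : ι → ℝ, (∀ i, 0 < x i) ∧ A *ᵥ x = c • x := by
  classical
  obtain ⟨B, hB, hAB, hBeig⟩ := exists_pos_matrix_commute hA
  obtain ⟨c, x, hx, hcx, hmax⟩ := exists_maximal_smul_le_mulVec hA.nonneg
  have heig := mulVec_eq_smul_of_maximal hB hAB hx hcx hmax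
  obtain ⟨d, hd⟩ := hBeig c x heig
  have hx0 : x ≠ 0 := by
    rintro rfl
    simpa using hx.2
  refine ⟨c, x, fun i => (hx.1 i).lt_of_ne' fun h0 => ?_, heig⟩
  have := mulVec_pos hB hx.1 hx0 i
  simp [hd, h0] at this

end PerronFrobenius

section MarkovShift

variable {K : ℕ} {S : Set (List (Fin K))} {m : ℕ}

/-- A nontrivial irreducible constraint of memory `m`: whether a word may be extended by a letter
depends only on the `m` letters next to it. -/
structure IsMarkovShift (S : Set (List (Fin K))) (m : ℕ) : Prop where
  mem_of_subword : ∀ {u w}, w ∈ S → u <:+: w → u ∈ S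
  glue : ∀ {a b u}, m ≤ u.length → a :: u ∈ S → u ++ [b] ∈ S → a :: (u ++ [b]) ∈ S
  connect : ∀ u ∈ S, ∀ v ∈ S, ∃ w, u ++ w ++ v ∈ S
  exists_ne_nil : ∃ w ∈ S, w ≠ []

lemma exists_constraint_length_le (hS : IsFiniteType S) : ∃ F : Finset (List (Fin K)),
    S = constraint F ∧ ∀ f ∈ F, f.length ≤ topologicalOrder S + 1 := by
  have hne : {L | ∃ F : Finset (List (Fin K)), S = constraint F ∧ F.sup List.length = L}.Nonempty :=
    hS.elim fun F hF => ⟨_, F, hF, rfl⟩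
  obtain ⟨F, hF, hL⟩ := Nat.sInf_mem hne
  refine ⟨F, hF, fun f hf => (Finset.le_sup (f := List.length) hf).trans ?_⟩
  rw [hL, topologicalOrder]
  exact Nat.le_add_of_sub_le le_rfl

lemma isMarkovShift_topologicalOrder (hS : IsFiniteType S) (hirr : IsIrreducibleConstraint S)
    (hne : ∃ w ∈ S, w ≠ []) : IsMarkovShift S (topologicalOrder S) where
  mem_of_subword := by
    obtain ⟨F, rfl⟩ := hS
    exact fun hw huw f hf hfu => hw f hf (hfu.trans huw)
  glue {a b u} hu hau hub := by
    obtain ⟨F, hF, hlen⟩ := exists_constraint_length_le hS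
    rw [hF] at hau hub ⊢
    intro f hf hfu
    rcases List.infix_cons_iff.1 hfu with hhead | htail
    · refine hau f hf (List.prefix_of_prefix_length_le hhead ⟨[b], rfl⟩ ?_).isInfix
      exact (hlen f hf).trans (Nat.succ_le_succ hu)
    · exact hub f hf htail
  connect u hu v hv := (hirr u hu v hv).imp fun _ h => h.2
  exists_ne_nil := hne

/-- The states of the shift: its allowed words of length `m`. -/
abbrev State (S : Set (List (Fin K))) (m : ℕ) : Type := {w : List (Fin K) // w ∈ S ∧ w.length = m}

noncomputable instance : Fintype (State S m) :=
  haveI : Finite (State S m) :=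
    ((List.finite_length_eq (Fin K) m).subset fun _ hw => hw.2).to_subtype
  Fintype.ofFinite _

open scoped Classical in
/-- Counts the letters which, put in front of the state `u`, lead to the state `v`. -/
noncomputable def transitionMatrix (S : Set (List (Fin K))) (m : ℕ) :
    Matrix (State S m) (State S m) ℝ :=
  fun u v => ∑ a, if a :: u.1 ∈ S ∧ (a :: u.1).take m = v then 1 else 0

/-- A positive left eigenfunction of the transitions of a shift of memory `m`, extended to all
words of length at least `m` through their first `m` letters; it takes arbitrary positive values
elsewhere. -/
structure IsLeftEigenfunction (S : Set (List (Fin K))) (m : ℕ) (c : ℝ) (l : List (Fin K) → ℝ) :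
    Prop where
  pos : ∀ w, 0 < l w
  concat : ∀ w b, m ≤ w.length → l (w ++ [b]) = l w
  sum_cons : ∀ w ∈ S, m ≤ w.length → ∑ a, S.indicator l (a :: w) = c * l w

/-- The mirror image of `IsLeftEigenfunction`: it depends on the last `m` letters. -/
structure IsRightEigenfunction (S : Set (List (Fin K))) (m : ℕ) (c : ℝ) (r : List (Fin K) → ℝ) :
    Prop where
  pos : ∀ w, 0 < r w
  cons : ∀ a w, m ≤ w.length → r (a :: w) = r w
  sum_concat : ∀ w ∈ S, m ≤ w.length → ∑ b, S.indicator r (w ++ [b]) = c * r w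

lemma IsLeftEigenfunction.reverse {c : ℝ} {l : List (Fin K) → ℝ}
    (hl : IsLeftEigenfunction (List.reverse ⁻¹' S) m c l) :
    IsRightEigenfunction S m c (l ∘ List.reverse) where
  pos w := hl.pos w.reverse
  cons a w hm := by
    simpa using hl.concat w.reverse a (by simpa using hm)
  sum_concat w hw hm := by
    classical
    simpa [Set.indicator_apply] using hl.sum_cons w.reverse (by simpa using hw) (by simpa using hm)

lemma IsLeftEigenfunction.const_mul {c d : ℝ} (hd : 0 < d) {l : List (Fin K) → ℝ}
    (hl : IsLeftEigenfunction S m c l) : IsLeftEigenfunction S m c fun w => d * l w where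
  pos w := mul_pos hd (hl.pos w)
  concat w b hm := by rw [hl.concat w b hm]
  sum_cons w hw hm := by
    simp only [Set.indicator_const_mul, ← Finset.mul_sum, hl.sum_cons w hw hm, mul_left_comm]

namespace IsMarkovShift

lemma nil_mem (h : IsMarkovShift S m) : [] ∈ S := by
  obtain ⟨w, hw, -⟩ := h.exists_ne_nil
  exact h.mem_of_subword hw List.nil_infix

lemma neZero (h : IsMarkovShift S m) : NeZero K := by
  obtain ⟨w, -, hw⟩ := h.exists_ne_nil
  obtain ⟨a, w, rfl⟩ := List.exists_cons_of_ne_nil hw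
  exact ⟨by rintro rfl; exact a.elim0⟩

lemma mem_of_concat (h : IsMarkovShift S m) {w : List (Fin K)} {b : Fin K} (hw : w ++ [b] ∈ S) :
    w ∈ S :=
  h.mem_of_subword hw (List.prefix_append w [b]).isInfix

lemma mem_of_cons (h : IsMarkovShift S m) {w : List (Fin K)} {a : Fin K} (hw : a :: w ∈ S) :
    w ∈ S :=
  h.mem_of_subword hw (List.suffix_cons a w).isInfix

lemma take_mem (h : IsMarkovShift S m) {w : List (Fin K)} (hw : w ∈ S) (n : ℕ) : w.take n ∈ S :=
  h.mem_of_subword hw (List.take_prefix n w).isInfix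

lemma reverse (h : IsMarkovShift S m) : IsMarkovShift (List.reverse ⁻¹' S) m where
  mem_of_subword hw huw := h.mem_of_subword hw (List.reverse_infix.2 huw)
  glue {a b u} hu hau hub := by
    simp only [Set.mem_preimage, List.reverse_cons, List.reverse_append, List.reverse_nil,
      List.nil_append, List.cons_append] at hau hub ⊢
    exact h.glue (by simpa using hu) hub hau
  connect u hu v hv := by
    obtain ⟨w, hw⟩ := h.connect _ hv _ hu
    exact ⟨w.reverse, by simpa using hw⟩
  exists_ne_nil := by
    obtain ⟨w, hw, hne⟩ := h.exists_ne_nil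
    exact ⟨w.reverse, by simpa using hw, by simpa using hne⟩

lemma exists_append_mem (h : IsMarkovShift S m) {w : List (Fin K)} (hw : w ∈ S) (n : ℕ) :
    ∃ u, w ++ u ∈ S ∧ n ≤ u.length := by
  induction n with
  | zero => exact ⟨[], by simpa using hw, le_rfl⟩
  | succ n ih =>
    obtain ⟨u, hu, hn⟩ := ih
    obtain ⟨v, hv, hne⟩ := h.exists_ne_nil
    obtain ⟨t, ht⟩ := h.connect _ hu v hv
    have := List.length_pos_iff.2 hne
    exact ⟨u ++ t ++ v, by simpa using ht, by simp only [List.length_append]; omega⟩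

lemma exists_mem_length (h : IsMarkovShift S m) (n : ℕ) : ∃ w ∈ S, w.length = n := by
  obtain ⟨u, hu, hn⟩ := h.exists_append_mem h.nil_mem n
  exact ⟨u.take n, h.take_mem hu n, List.length_take_of_le hn⟩

lemma nonempty_state (h : IsMarkovShift S m) : Nonempty (State S m) :=
  (h.exists_mem_length m).elim fun w hw => ⟨⟨w, hw⟩⟩

lemma cons_mem_iff (h : IsMarkovShift S m) {w : List (Fin K)} {a : Fin K} (hw : w ∈ S)
    (hm : m ≤ w.length) : a :: w ∈ S ↔ a :: w.take m ∈ S := by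
  refine ⟨fun ha => h.take_mem ha (m + 1), fun ha => ?_⟩
  induction w using List.reverseRecOn with
  | nil => simpa using ha
  | append_singleton w b ih =>
    rcases Nat.lt_or_ge w.length m with hlt | hge
    · rwa [List.take_of_length_le (by simpa using hlt)] at ha
    · rw [List.take_append_of_le_length hge] at ha
      exact h.glue hge (ih (h.mem_of_concat hw) hge ha) hw

lemma exists_ne_nil_append_mem (h : IsMarkovShift S m) {u v : List (Fin K)} (hu : u ∈ S)
    (hv : v ∈ S) : ∃ y ≠ [], v ++ y ++ u ∈ S := by
  obtain ⟨t, ht, hne⟩ := h.exists_ne_nil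
  obtain ⟨w₁, hw₁⟩ := h.connect v hv t ht
  obtain ⟨w₂, hw₂⟩ := h.connect _ hw₁ u hu
  exact ⟨w₁ ++ t ++ w₂, by simp [hne], by simpa using hw₂⟩

lemma transitionMatrix_nonneg (u v : State S m) : 0 ≤ transitionMatrix S m u v :=
  Finset.sum_nonneg fun a _ => by split_ifs <;> norm_num

lemma transitionMatrix_pos {u v : State S m} {a : Fin K} (ha : a :: u.1 ∈ S)
    (hv : (a :: u.1).take m = v) : 0 < transitionMatrix S m u v :=
  Finset.sum_pos' (fun b _ => by split_ifs <;> norm_num)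
    ⟨a, Finset.mem_univ a, by rw [if_pos ⟨ha, hv⟩]; exact one_pos⟩

open scoped Classical in
lemma transitionMatrix_pow_pos (h : IsMarkovShift S m) {u v : State S m} {y : List (Fin K)}
    (hy : y ++ u.1 ∈ S) (hv : (y ++ u.1).take m = v) :
    0 < (transitionMatrix S m ^ y.length) u v := by
  induction y generalizing v with
  | nil =>
    have huv : u = v := Subtype.ext (by rw [← hv, List.nil_append, List.take_of_length_le u.2.2.le])
    simp [huv]
  | cons a y ih =>
    have hyu : y ++ u.1 ∈ S := h.mem_of_cons hy
    let s : State S m := ⟨(y ++ u.1).take m, h.take_mem hyu m,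
      List.length_take_of_le (by simp [u.2.2])⟩
    have hstep : 0 < transitionMatrix S m s v := by
      refine transitionMatrix_pos (a := a) (h.take_mem hy (m + 1)) ?_
      rw [← hv, ← List.take_succ_cons, List.take_take, min_eq_left m.le_succ, List.cons_append]
    rw [List.length_cons, pow_succ, Matrix.mul_apply]
    exact Finset.sum_pos' (fun t _ => mul_nonneg
      (Matrix.pow_apply_nonneg transitionMatrix_nonneg _ _ _) (transitionMatrix_nonneg _ _))
      ⟨s, Finset.mem_univ s, mul_pos (ih hyu rfl) hstep⟩

lemma isIrreducible_transitionMatrix (h : IsMarkovShift S m) :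
    (transitionMatrix S m).IsIrreducible := by
  classical
  refine (Matrix.isIrreducible_iff_exists_pow_pos transitionMatrix_nonneg).2 fun u v => ?_
  obtain ⟨y, hy, hmem⟩ := h.exists_ne_nil_append_mem u.2.1 v.2.1
  exact ⟨(v.1 ++ y).length, by simp [List.length_pos_iff.2 hy],
    h.transitionMatrix_pow_pos hmem (by rw [List.append_assoc, List.take_left' v.2.2])⟩

open Matrix in
lemma transitionMatrix_mulVec (h : IsMarkovShift S m) (f : List (Fin K) → ℝ) (u : State S m) :
    (transitionMatrix S m *ᵥ fun v => f v) u =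
      ∑ a, S.indicator (fun w => f (w.take m)) (a :: u.1) := by
  classical
  simp only [Matrix.mulVec, dotProduct, transitionMatrix, Finset.sum_mul]
  rw [Finset.sum_comm]
  refine Finset.sum_congr rfl fun a _ => ?_
  by_cases ha : a :: u.1 ∈ S
  · let s : State S m := ⟨(a :: u.1).take m, h.take_mem ha m,
      List.length_take_of_le (by simp [u.2.2])⟩
    rw [Set.indicator_of_mem ha, Finset.sum_eq_single s _ (by simp), if_pos ⟨ha, rfl⟩, one_mul]
    exact fun v _ hv => by rw [if_neg fun hs => hv (Subtype.ext hs.2.symm), zero_mul]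
  · simp [ha]

lemma exists_isLeftEigenfunction (h : IsMarkovShift S m) :
    ∃ c l, IsLeftEigenfunction S m c l := by
  have := h.nonempty_state
  obtain ⟨c, x, hx, heig⟩ :=
    exists_pos_eigenvector_of_isIrreducible h.isIrreducible_transitionMatrix
  let f : List (Fin K) → ℝ := Function.extend Subtype.val x fun _ => 1
  have hf : ∀ u : State S m, f u = x u := Subtype.val_injective.extend_apply x _
  refine ⟨c, fun w => f (w.take m), fun w => ?_, fun w b hm => ?_, fun w hw hm => ?_⟩
  · by_cases hw : ∃ u : State S m, u = w.take m
    · obtain ⟨u, hu⟩ := hw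
      simpa only [← hu, hf] using hx u
    · simp only [f, Function.extend_apply' _ _ _ hw, one_pos]
  · simp only [List.take_append_of_le_length hm]
  · let u : State S m := ⟨w.take m, h.take_mem hw m, List.length_take_of_le hm⟩
    have hu : ∑ a, S.indicator (fun w => f (w.take m)) (a :: u.1) = c * f u := by
      rw [← h.transitionMatrix_mulVec, hf, ← smul_eq_mul, ← Pi.smul_apply, ← heig]
      simp only [hf]
    refine Eq.trans (Finset.sum_congr rfl fun a _ => ?_) hu
    have htake : (a :: w).take m = (a :: w.take m).take m := by
      rw [← List.take_succ_cons, List.take_take, min_eq_left m.le_succ]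
    by_cases ha : a :: w ∈ S
    · rw [Set.indicator_of_mem ha, Set.indicator_of_mem ((h.cons_mem_iff hw hm).1 ha), htake]
    · rw [Set.indicator_of_notMem ha, Set.indicator_of_notMem (mt (h.cons_mem_iff hw hm).2 ha)]

lemma wordSum_succ_mul_of_isLeftEigenfunction (h : IsMarkovShift S m) {c : ℝ}
    {l r : List (Fin K) → ℝ} (hl : IsLeftEigenfunction S m c l)
    (hr : ∀ a w, m ≤ w.length → r (a :: w) = r w) :
    wordSum (m + 1) (S.indicator fun w => l w * r w) =
      c * wordSum m (S.indicator fun w => l w * r w) := by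
  rw [wordSum_succ, ← wordSum_const_mul]
  refine wordSum_congr fun w hw => ?_
  by_cases hwS : w ∈ S
  · simp only [Set.indicator_mul_left, hr _ w hw.ge, ← Finset.sum_mul, hl.sum_cons w hwS hw.ge,
      Set.indicator_of_mem hwS, mul_assoc]
  · simp only [Set.indicator_of_notMem hwS, Set.indicator_of_notMem (mt h.mem_of_cons hwS),
      Finset.sum_const_zero, mul_zero]

lemma wordSum_succ_mul_of_isRightEigenfunction (h : IsMarkovShift S m) {c : ℝ}
    {l r : List (Fin K) → ℝ} (hl : ∀ w b, m ≤ w.length → l (w ++ [b]) = l w)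
    (hr : IsRightEigenfunction S m c r) :
    wordSum (m + 1) (S.indicator fun w => l w * r w) =
      c * wordSum m (S.indicator fun w => l w * r w) := by
  rw [wordSum_succ_last, ← wordSum_const_mul]
  refine wordSum_congr fun w hw => ?_
  by_cases hwS : w ∈ S
  · simp only [Set.indicator_mul_right, hl w _ hw.ge, ← Finset.mul_sum, hr.sum_concat w hwS hw.ge,
      Set.indicator_of_mem hwS, mul_left_comm]
  · simp only [Set.indicator_of_notMem hwS, Set.indicator_of_notMem (mt h.mem_of_concat hwS),
      Finset.sum_const_zero, mul_zero]

lemma wordSum_indicator_mul_pos (h : IsMarkovShift S m) {l r : List (Fin K) → ℝ}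
    (hl : ∀ w, 0 < l w) (hr : ∀ w, 0 < r w) :
    0 < wordSum m (S.indicator fun w => l w * r w) := by
  obtain ⟨w, hw, hlen⟩ := h.exists_mem_length m
  refine (mul_pos (hl w) (hr w)).trans_le ?_
  have hle := le_wordSum (f := S.indicator fun w => l w * r w)
    (fun v _ => Set.indicator_nonneg (fun v _ => (mul_pos (hl v) (hr v)).le) v) hlen
  rwa [Set.indicator_of_mem hw] at hle

lemma eigenvalue_pos (h : IsMarkovShift S m) {c : ℝ} {l : List (Fin K) → ℝ}
    (hl : IsLeftEigenfunction S m c l) : 0 < c := by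
  obtain ⟨x, hx, hlen⟩ := h.exists_mem_length (m + 1)
  obtain ⟨a, w, rfl⟩ := List.exists_cons_of_length_eq_add_one hlen
  have hm : m ≤ w.length := (Nat.succ_injective hlen).ge
  refine pos_of_mul_pos_left ?_ (hl.pos w).le
  rw [← hl.sum_cons w (h.mem_of_cons hx) hm]
  exact Finset.sum_pos' (fun b _ => Set.indicator_nonneg (fun v _ => (hl.pos v).le) _)
    ⟨a, Finset.mem_univ a, by rw [Set.indicator_of_mem hx]; exact hl.pos _⟩

/-- The left and right eigenvalues agree since both are the growth factor from `m` to `m + 1` of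
the total weight `∑ l w * r w`. -/
lemma exists_eigenfunctions (h : IsMarkovShift S m) :
    ∃ c l r, IsLeftEigenfunction S m c l ∧ IsRightEigenfunction S m c r ∧
      wordSum m (S.indicator fun w => l w * r w) = 1 := by
  obtain ⟨c, l, hl⟩ := h.exists_isLeftEigenfunction
  obtain ⟨c', r', hr'⟩ := h.reverse.exists_isLeftEigenfunction
  set r := r' ∘ List.reverse
  have hr : IsRightEigenfunction S m c' r := hr'.reverse
  have hpos := h.wordSum_indicator_mul_pos hl.pos hr.pos
  obtain rfl : c = c' := mul_right_cancel₀ hpos.ne' <|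
    (h.wordSum_succ_mul_of_isLeftEigenfunction hl hr.cons).symm.trans
      (h.wordSum_succ_mul_of_isRightEigenfunction hl.concat hr)
  refine ⟨c, _, r, hl.const_mul (inv_pos.2 hpos), hr, ?_⟩
  refine Eq.trans (wordSum_congr fun w _ => ?_)
    ((wordSum_const_mul m _ _).trans (inv_mul_cancel₀ hpos.ne'))
  simp only [mul_assoc, Set.indicator_const_mul]

end IsMarkovShift

end MarkovShift

section Parry

variable {K : ℕ} {S : Set (List (Fin K))} {m : ℕ} {c : ℝ} {l r ρ P : List (Fin K) → ℝ}

/-- The word probabilities `l w * r w / c ^ (|w| - m)` of the Parry measure of a shift of memory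
`m`, for words of length at least `m`. -/
noncomputable def parryProb (S : Set (List (Fin K))) (m : ℕ) (c : ℝ) (l r : List (Fin K) → ℝ) :
    List (Fin K) → ℝ :=
  S.indicator fun w => l w * r w / c ^ (w.length - m)

/-- `P` is a consistent family of word probabilities, supported exactly on `S`, under which the
letter `b` follows `w` with probability `ρ (w ++ [b]) / (c * ρ w)`. -/
structure IsParry (S : Set (List (Fin K))) (m : ℕ) (c : ℝ) (ρ P : List (Fin K) → ℝ) : Prop where
  isConsistent : IsConsistent m P
  pos_iff : ∀ w, m ≤ w.length → (0 < P w ↔ w ∈ S)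
  eigenvalue_pos : 0 < c
  eigenfunction_pos : ∀ w, 0 < ρ w
  eigenfunction_cons : ∀ a w, m ≤ w.length → ρ (a :: w) = ρ w
  transition : ∀ w b, m ≤ w.length → w ++ [b] ∈ S → P (w ++ [b]) * (c * ρ w) = P w * ρ (w ++ [b])

namespace IsMarkovShift

lemma sum_parryProb_concat (h : IsMarkovShift S m) (hc : c ≠ 0)
    (hl : ∀ w b, m ≤ w.length → l (w ++ [b]) = l w) (hr : IsRightEigenfunction S m c r)
    {w : List (Fin K)} (hm : m ≤ w.length) :
    ∑ b, parryProb S m c l r (w ++ [b]) = parryProb S m c l r w := by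
  have hlen (b : Fin K) : (w ++ [b]).length - m = w.length - m + 1 := by
    rw [List.length_append, List.length_singleton, Nat.sub_add_comm hm]
  by_cases hw : w ∈ S
  · have hterm (b : Fin K) : parryProb S m c l r (w ++ [b]) =
        l w / c ^ (w.length - m + 1) * S.indicator r (w ++ [b]) := by
      by_cases hb : w ++ [b] ∈ S
      · rw [parryProb, Set.indicator_of_mem hb, Set.indicator_of_mem hb, hl w b hm, hlen]
        ring
      · simp [parryProb, hb]
    simp only [hterm, ← Finset.mul_sum, hr.sum_concat w hw hm]
    rw [parryProb, Set.indicator_of_mem hw, pow_succ]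
    field_simp
  · simp only [parryProb, Set.indicator_of_notMem hw,
      Set.indicator_of_notMem (mt h.mem_of_concat hw), Finset.sum_const_zero]

lemma sum_parryProb_cons (h : IsMarkovShift S m) (hc : c ≠ 0) (hl : IsLeftEigenfunction S m c l)
    (hr : ∀ a w, m ≤ w.length → r (a :: w) = r w) {w : List (Fin K)} (hm : m ≤ w.length) :
    ∑ a, parryProb S m c l r (a :: w) = parryProb S m c l r w := by
  by_cases hw : w ∈ S
  · have hterm (a : Fin K) : parryProb S m c l r (a :: w) =
        r w / c ^ (w.length - m + 1) * S.indicator l (a :: w) := by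
      by_cases ha : a :: w ∈ S
      · rw [parryProb, Set.indicator_of_mem ha, Set.indicator_of_mem ha, hr a w hm,
          List.length_cons, Nat.sub_add_comm hm]
        ring
      · simp [parryProb, ha]
    simp only [hterm, ← Finset.mul_sum, hl.sum_cons w hw hm]
    rw [parryProb, Set.indicator_of_mem hw, pow_succ]
    field_simp
  · simp only [parryProb, Set.indicator_of_notMem hw,
      Set.indicator_of_notMem (mt h.mem_of_cons hw), Finset.sum_const_zero]

lemma exists_isParry (h : IsMarkovShift S m) : ∃ c ρ P, IsParry S m c ρ P := by
  obtain ⟨c, l, r, hl, hr, hone⟩ := h.exists_eigenfunctions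
  have hc := h.eigenvalue_pos hl
  have hpos (w : List (Fin K)) : 0 < l w * r w / c ^ (w.length - m) :=
    div_pos (mul_pos (hl.pos w) (hr.pos w)) (pow_pos hc _)
  refine ⟨c, r, parryProb S m c l r, ⟨⟨fun w => ?_, fun w => ?_, fun w => ?_, ?_⟩,
    fun w _ => ?_, hc, hr.pos, hr.cons, fun w b hm hb => ?_⟩⟩
  · exact Set.indicator_nonneg (fun w _ => (hpos w).le) w
  · exact h.sum_parryProb_concat hc.ne' hl.concat hr
  · exact h.sum_parryProb_cons hc.ne' hl hr.cons
  · rw [← hone]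
    refine wordSum_congr fun w hw => ?_
    simp [parryProb, Set.indicator, hw]
  · by_cases hw : w ∈ S <;> simp [parryProb, hw, hpos]
  · rw [parryProb, Set.indicator_of_mem hb, Set.indicator_of_mem (h.mem_of_concat hb),
      hl.concat w b hm, List.length_append, List.length_singleton, Nat.sub_add_comm hm, pow_succ]
    field_simp

end IsMarkovShift

namespace IsParry

lemma eq_zero_of_notMem (hP : IsParry S m c ρ P) {w : List (Fin K)} (hm : m ≤ w.length)
    (hw : w ∉ S) : P w = 0 :=
  ((hP.isConsistent.nonneg w).eq_or_lt.resolve_right (mt (hP.pos_iff w hm).1 hw)).symm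

lemma transition_cons (hP : IsParry S m c ρ P) (hS : IsMarkovShift S m) {a b : Fin K}
    {w : List (Fin K)} (hm : m ≤ w.length) (hw : a :: w ∈ S) :
    P (a :: (w ++ [b])) / P (a :: w) = P (w ++ [b]) / P w := by
  have hm' : m ≤ (a :: w).length := hm.trans (Nat.le_succ _)
  have hlen : m ≤ (w ++ [b]).length := by
    rw [List.length_append]
    exact hm.trans (Nat.le_add_right _ _)
  by_cases hb : a :: (w ++ [b]) ∈ S
  · have h₁ := hP.transition (a :: w) b hm' hb
    have h₂ := hP.transition w b hm (hS.mem_of_cons hb)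
    rw [List.cons_append, hP.eigenfunction_cons a w hm, hP.eigenfunction_cons a _ hlen] at h₁
    have hcρ := (mul_pos hP.eigenvalue_pos (hP.eigenfunction_pos w)).ne'
    rw [div_eq_div_iff ((hP.pos_iff _ hm').2 hw).ne'
      ((hP.pos_iff _ hm).2 (hS.mem_of_cons hw)).ne']
    refine mul_right_cancel₀ hcρ ?_
    linear_combination P w * h₁ - P (a :: w) * h₂
  · rw [hP.eq_zero_of_notMem (hlen.trans (Nat.le_succ _)) hb,
      hP.eq_zero_of_notMem hlen (mt (hS.glue hm hw) hb), zero_div, zero_div]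

lemma transition_append (hP : IsParry S m c ρ P) (hS : IsMarkovShift S m) (d : List (Fin K))
    {b : Fin K} {w : List (Fin K)} (hm : m ≤ w.length) (hw : d ++ w ∈ S) :
    P (d ++ w ++ [b]) / P (d ++ w) = P (w ++ [b]) / P w := by
  induction d with
  | nil => rfl
  | cons a d ih =>
    rw [← ih (hS.mem_of_cons hw)]
    have hdw : m ≤ (d ++ w).length := hm.trans (by simp)
    exact hP.transition_cons hS hdw hw

end IsParry

lemma IsConsistent.exists_isStationaryLaw [NeZero K] (hP : IsConsistent m P) :
    ∃ μ : Measure (ℤ → Fin K), IsStationaryLaw μ ∧ ∀ w, m ≤ w.length → wordProb μ w = P w := by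
  obtain ⟨μ, hμ, hw⟩ := hP.exists_measure
  have hshift : Measurable (shift (K := K)) := measurable_pi_lambda _ fun _ => measurable_pi_apply _
  have := Measure.isProbabilityMeasure_map (μ := μ) hshift.aemeasurable
  refine ⟨μ, ⟨hμ, hshift, measure_ext_of_wordEvent m fun i w hm => ?_⟩, fun w hm => hw 0 w hm⟩
  have hpre : shift ⁻¹' wordEvent i w = wordEvent (i + 1) w :=
    Set.ext fun _ => shift_mem_wordEvent
  rw [Measure.map_apply hshift (measurableSet_wordEvent i w), hpre,
    ← measureReal_eq_measureReal_iff, hw _ _ hm, hw _ _ hm]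

end Parry

section MarkovLaw

variable {K : ℕ} {m : ℕ} {μ : Measure (ℤ → Fin K)}

lemma length_wordAt (x : ℤ → Fin K) (i : ℤ) (l : ℕ) : (wordAt x i l).length = l :=
  List.length_ofFn

lemma wordAt_add (x : ℤ → Fin K) (i : ℤ) (d l : ℕ) :
    wordAt x i (d + l) = wordAt x i d ++ wordAt x (i + d) l := by
  simp [wordAt, List.ofFn_add, add_assoc]

lemma agreeOn_Ico_eq_wordEvent (t : ℤ) (k : ℕ) (z : ℤ → Fin K) :
    agreeOn (Set.Ico (t - k) t) z = wordEvent (t - k) (wordAt z (t - k) k) := by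
  ext x
  rw [mem_wordEvent, length_wordAt, wordAt, wordAt, List.ofFn_inj, funext_iff]
  refine ⟨fun h j => h _ ⟨by omega, by omega⟩, fun h i hi => ?_⟩
  obtain ⟨j, rfl⟩ : ∃ j : ℕ, i = t - k + j := ⟨(i - (t - k)).toNat, by have := hi.1; omega⟩
  exact h ⟨j, by have := hi.2; omega⟩

lemma agreeOn_Ico_inter_eq_wordEvent (t : ℤ) (k : ℕ) (z : ℤ → Fin K) :
    agreeOn (Set.Ico (t - k) t) z ∩ agreeOn {t} z =
      wordEvent (t - k) (wordAt z (t - k) k ++ [z t]) := by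
  ext x
  rw [mem_wordEvent_concat, ← agreeOn_Ico_eq_wordEvent, length_wordAt, sub_add_cancel]
  simp [agreeOn]

namespace IsStationaryLaw

lemma isConsistent (hμ : IsStationaryLaw μ) (m : ℕ) : IsConsistent m (wordProb μ) where
  nonneg := wordProb_nonneg μ
  sum_concat w _ := hμ.sum_wordProb_concat w
  sum_cons w _ := hμ.sum_wordProb_cons w
  wordSum_eq_one := hμ.wordSum_wordProb m

lemma cond_agreeOn_real (hμ : IsStationaryLaw μ) (t : ℤ) (k : ℕ) (z : ℤ → Fin K) :
    (μ[|agreeOn (Set.Ico (t - k) t) z]).real (agreeOn {t} z) =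
      wordProb μ (wordAt z (t - k) k ++ [z t]) / wordProb μ (wordAt z (t - k) k) := by
  have hmeas : MeasurableSet (agreeOn (Set.Ico (t - k) t) z) := by
    rw [agreeOn_Ico_eq_wordEvent]
    exact measurableSet_wordEvent _ _
  rw [measureReal_def, cond_apply hmeas, agreeOn_Ico_inter_eq_wordEvent, agreeOn_Ico_eq_wordEvent,
    ENNReal.toReal_mul, ENNReal.toReal_inv, ← measureReal_def, ← measureReal_def,
    hμ.measureReal_wordEvent, hμ.measureReal_wordEvent, inv_mul_eq_div]

lemma isMarkovOfOrder (hμ : IsStationaryLaw μ)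
    (h : ∀ d s b, s.length = m → d ++ s ∈ allowedWords μ →
      wordProb μ (d ++ s ++ [b]) / wordProb μ (d ++ s) = wordProb μ (s ++ [b]) / wordProb μ s) :
    IsMarkovOfOrder m μ := by
  intro t k z hk hne
  have := hμ.isProbabilityMeasure
  obtain ⟨d, rfl⟩ := Nat.exists_eq_add_of_le' hk
  rw [← measureReal_eq_measureReal_iff, hμ.cond_agreeOn_real, hμ.cond_agreeOn_real]
  have hsplit : wordAt z (t - (d + m : ℕ)) (d + m) =
      wordAt z (t - (d + m : ℕ)) d ++ wordAt z (t - m) m := by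
    rw [wordAt_add]
    congr 2
    push_cast
    ring
  rw [hsplit]
  refine h _ _ _ (length_wordAt _ _ _) ?_
  rw [← hsplit]
  refine ⟨t - (d + m : ℕ), pos_iff_ne_zero.2 ?_⟩
  rwa [agreeOn_Ico_eq_wordEvent] at hne

lemma mem_allowedWords_iff_exists_append (hμ : IsStationaryLaw μ) (n : ℕ) (w : List (Fin K)) :
    w ∈ allowedWords μ ↔ ∃ u, u.length = n ∧ w ++ u ∈ allowedWords μ := by
  induction n generalizing w with
  | zero => simp [List.length_eq_zero_iff]
  | succ n ih =>
    have hconcat : w ∈ allowedWords μ ↔ ∃ b, w ++ [b] ∈ allowedWords μ := by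
      simp only [hμ.mem_allowedWords, ← hμ.sum_wordProb_concat w]
      simpa using Finset.sum_pos_iff_of_nonneg fun b (_ : b ∈ Finset.univ) =>
        wordProb_nonneg μ (w ++ [b])
    rw [hconcat]
    constructor
    · rintro ⟨b, hb⟩
      obtain ⟨u, hu, hmem⟩ := (ih _).1 hb
      exact ⟨b :: u, by rw [List.length_cons, hu], by simpa using hmem⟩
    · rintro ⟨u, hu, hmem⟩
      obtain ⟨b, u, rfl⟩ := List.exists_cons_of_length_eq_add_one hu
      exact ⟨b, (ih _).2 ⟨u, Nat.succ_injective hu, by simpa using hmem⟩⟩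

end IsStationaryLaw

lemma IsParry.exists_law {S : Set (List (Fin K))} {c : ℝ} {ρ P : List (Fin K) → ℝ}
    (hP : IsParry S m c ρ P) (hS : IsMarkovShift S m) :
    ∃ μ : Measure (ℤ → Fin K), IsStationaryLaw μ ∧ IsMarkovOfOrder m μ ∧ allowedWords μ = S ∧
      IsParry S m c ρ (wordProb μ) := by
  have := hS.neZero
  obtain ⟨μ, hμ, hw⟩ := hP.isConsistent.exists_isStationaryLaw
  have mem_iff {w : List (Fin K)} (hm : m ≤ w.length) : w ∈ allowedWords μ ↔ w ∈ S := by
    rw [hμ.mem_allowedWords, hw w hm, hP.pos_iff w hm]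
  have le_append (u : List (Fin K)) {v : List (Fin K)} (hm : m ≤ v.length) : m ≤ (u ++ v).length :=
    hm.trans (by simp)
  refine ⟨μ, hμ, hμ.isMarkovOfOrder fun d s b hs hds => ?_, Set.ext fun w => ?_,
    { hP with
      isConsistent := hμ.isConsistent m
      pos_iff := fun w hm => by rw [hw w hm, hP.pos_iff w hm]
      transition := fun w b hm => by
        rw [hw w hm, hw _ (hm.trans (by simp))]
        exact hP.transition w b hm }⟩
  · have hle := le_append d hs.ge
    rw [hw _ hle, hw s hs.ge, hw _ (hle.trans (by simp)), hw _ (hs.ge.trans (by simp))]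
    exact hP.transition_append hS d hs.ge ((mem_iff hle).1 hds)
  · rw [hμ.mem_allowedWords_iff_exists_append m]
    constructor
    · rintro ⟨u, hu, hmem⟩
      exact hS.mem_of_subword ((mem_iff (le_append w hu.ge)).1 hmem)
        (List.prefix_append w u).isInfix
    · intro hwS
      obtain ⟨u, hu, hm⟩ := hS.exists_append_mem hwS m
      refine ⟨u.take m, List.length_take_of_le hm,
        (mem_iff (le_append w (List.length_take_of_le hm).ge)).2 (hS.mem_of_subword hu ?_)⟩
      exact ((List.prefix_append_right_inj w).2 (List.take_prefix m u)).isInfix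

end MarkovLaw

section EntropyGap

lemma sub_add_sq_le_mul_log_sub {p q : ℝ} (hp : 0 ≤ p) (hp1 : p ≤ 1) (hq : 0 ≤ q) (hq1 : q ≤ 1)
    (hpq : q = 0 → p = 0) : p - q + (p - q) ^ 2 / 4 ≤ p * (Real.log p - Real.log q) := by
  rcases hp.eq_or_lt with rfl | hp
  · nlinarith
  have hq : 0 < q := hq.lt_of_ne' (mt hpq hp.ne')
  obtain ⟨a, ha, rfl⟩ : ∃ a, 0 < a ∧ p = a ^ 2 :=
    ⟨√p, Real.sqrt_pos.2 hp, (Real.sq_sqrt hp.le).symm⟩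
  obtain ⟨b, hb, rfl⟩ : ∃ b, 0 < b ∧ q = b ^ 2 :=
    ⟨√q, Real.sqrt_pos.2 hq, (Real.sq_sqrt hq.le).symm⟩
  have ha1 : a ≤ 1 := (sq_le_one_iff₀ ha.le).1 hp1
  have hb1 : b ≤ 1 := (sq_le_one_iff₀ hb.le).1 hq1
  have hlog : 2 * a * (a - b) ≤ a ^ 2 * (Real.log (a ^ 2) - Real.log (b ^ 2)) := by
    have h := mul_le_mul_of_nonneg_left (Real.log_le_sub_one_of_pos (div_pos hb ha))
      (by positivity : 0 ≤ 2 * a ^ 2)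
    have hdiv : 2 * a ^ 2 * (b / a - 1) = 2 * a * (b - a) := by field_simp
    rw [Real.log_div hb.ne' ha.ne', hdiv] at h
    rw [Real.log_pow, Real.log_pow]
    push_cast
    linarith
  have hsq : (a ^ 2 - b ^ 2) ^ 2 / 4 ≤ (a - b) ^ 2 := by
    have hab : (a + b) ^ 2 ≤ 4 := by nlinarith
    nlinarith [mul_le_mul_of_nonneg_left hab (sq_nonneg (a - b))]
  linarith

section Consistent

variable {α : Type*} [Fintype α] {m : ℕ} {Q : List α → ℝ}

namespace IsConsistent

lemma mono (hQ : IsConsistent m Q) {n : ℕ} (hmn : m ≤ n) : IsConsistent n Q where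
  nonneg := hQ.nonneg
  sum_concat w hn := hQ.sum_concat w (hmn.trans hn)
  sum_cons w hn := hQ.sum_cons w (hmn.trans hn)
  wordSum_eq_one := hQ.wordSum_of_le hmn

lemma le_one (hQ : IsConsistent m Q) {w : List α} (hm : m ≤ w.length) : Q w ≤ 1 := by
  rw [← hQ.wordSum_of_le hm]
  exact le_wordSum (fun v _ => hQ.nonneg v) rfl

lemma concat_le (hQ : IsConsistent m Q) {w : List α} (hm : m ≤ w.length) (b : α) :
    Q (w ++ [b]) ≤ Q w := by
  rw [← hQ.sum_concat w hm]
  exact Finset.single_le_sum (f := fun b => Q (w ++ [b])) (fun b _ => hQ.nonneg _)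
    (Finset.mem_univ b)

lemma wordSum_negMulLog_succ_sub (hQ : IsConsistent m Q) :
    wordSum (m + 1) (fun w => Real.negMulLog (Q w)) - wordSum m (fun w => Real.negMulLog (Q w)) =
      -wordSum m fun w => ∑ b, Q (w ++ [b]) * (Real.log (Q (w ++ [b])) - Real.log (Q w)) := by
  rw [wordSum_succ_last, wordSum, wordSum, wordSum, ← Finset.sum_sub_distrib,
    ← Finset.sum_neg_distrib]
  refine Finset.sum_congr rfl fun z _ => ?_
  simp only [mul_sub, Finset.sum_sub_distrib, ← Finset.sum_mul, Real.negMulLog, neg_mul,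
    Finset.sum_neg_distrib, hQ.sum_concat (List.ofFn z) List.length_ofFn.ge]
  ring

end IsConsistent

end Consistent

variable {K : ℕ} {S : Set (List (Fin K))} {m : ℕ} {c : ℝ} {ρ P Q : List (Fin K) → ℝ}

lemma IsMarkovShift.mono (hS : IsMarkovShift S m) {n : ℕ} (hmn : m ≤ n) : IsMarkovShift S n :=
  { hS with glue := fun hn => hS.glue (hmn.trans hn) }

namespace IsParry

lemma mono (hP : IsParry S m c ρ P) {n : ℕ} (hmn : m ≤ n) : IsParry S n c ρ P where
  isConsistent := hP.isConsistent.mono hmn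
  pos_iff w hn := hP.pos_iff w (hmn.trans hn)
  eigenvalue_pos := hP.eigenvalue_pos
  eigenfunction_pos := hP.eigenfunction_pos
  eigenfunction_cons a w hn := hP.eigenfunction_cons a w (hmn.trans hn)
  transition w b hn := hP.transition w b (hmn.trans hn)

lemma log_concat_sub_log (hP : IsParry S m c ρ P) (hS : IsMarkovShift S m) {w : List (Fin K)}
    {b : Fin K} (hm : m ≤ w.length) (hb : w ++ [b] ∈ S) :
    Real.log (P (w ++ [b])) - Real.log (P w) =
      Real.log (ρ (w ++ [b])) - Real.log c - Real.log (ρ w) := by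
  have hPw := (hP.pos_iff w hm).2 (hS.mem_of_concat hb)
  have hPb := (hP.pos_iff (w ++ [b]) (hm.trans (by simp))).2 hb
  have hc := hP.eigenvalue_pos
  have hρ := hP.eigenfunction_pos
  have hlog := congrArg Real.log (hP.transition w b hm hb)
  rw [Real.log_mul hPb.ne' (mul_pos hc (hρ w)).ne', Real.log_mul hc.ne' (hρ w).ne',
    Real.log_mul hPw.ne' (hρ _).ne'] at hlog
  linarith

/-- Since `ρ` only depends on the last `m` letters, the sum of the differences
`log ρ (w ++ [b]) - log ρ w` vanishes by stationarity. -/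
lemma wordSum_mul_log_sub (hP : IsParry S m c ρ P) (hS : IsMarkovShift S m)
    (hQ : IsConsistent m Q) (hQS : ∀ w, m ≤ w.length → w ∉ S → Q w = 0) :
    wordSum m (fun w => ∑ b, Q (w ++ [b]) * (Real.log (P (w ++ [b])) - Real.log (P w))) =
      -Real.log c := by
  have hterm (w : List (Fin K)) (hw : w.length = m) :
      ∑ b, Q (w ++ [b]) * (Real.log (P (w ++ [b])) - Real.log (P w)) =
        ∑ b, Q (w ++ [b]) * Real.log (ρ (w ++ [b])) - Q w * Real.log (ρ w) -
          Q w * Real.log c := by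
    rw [← hQ.sum_concat w hw.ge, Finset.sum_mul, Finset.sum_mul, ← Finset.sum_sub_distrib,
      ← Finset.sum_sub_distrib]
    refine Finset.sum_congr rfl fun b _ => ?_
    by_cases hb : w ++ [b] ∈ S
    · rw [hP.log_concat_sub_log hS hw.ge hb]
      ring
    · simp only [hQS _ (hw.ge.trans (by simp)) hb, zero_mul, sub_zero]
  have hcycle : wordSum m (fun w => ∑ b, Q (w ++ [b]) * Real.log (ρ (w ++ [b]))) =
      wordSum m fun w => Q w * Real.log (ρ w) := by
    rw [← wordSum_succ_last m fun w => Q w * Real.log (ρ w), wordSum_succ]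
    refine wordSum_congr fun w hw => ?_
    simp only [hP.eigenfunction_cons _ w hw.ge, ← Finset.sum_mul, hQ.sum_cons w hw.ge]
  have hone : wordSum m (fun w => Q w * Real.log c) = Real.log c := by
    simp only [mul_comm (Q _), wordSum_const_mul, hQ.wordSum_eq_one, mul_one]
  rw [wordSum_congr hterm]
  simp only [wordSum, Finset.sum_sub_distrib] at hcycle hone ⊢
  rw [hcycle, hone, sub_self, zero_sub]

lemma log_sub_eq_wordSum (hP : IsParry S m c ρ P) (hS : IsMarkovShift S m)
    (hQ : IsConsistent m Q) (hQS : ∀ w, m ≤ w.length → w ∉ S → Q w = 0) :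
    Real.log c - (wordSum (m + 1) (fun w => Real.negMulLog (Q w)) -
        wordSum m fun w => Real.negMulLog (Q w)) =
      wordSum m fun w => ∑ b, Q (w ++ [b]) * (Real.log (Q (w ++ [b])) - Real.log (Q w) -
        (Real.log (P (w ++ [b])) - Real.log (P w))) := by
  have hlog := hP.wordSum_mul_log_sub hS hQ hQS
  rw [hQ.wordSum_negMulLog_succ_sub, ← neg_neg (Real.log c), ← hlog]
  simp only [mul_sub, wordSum, Finset.sum_sub_distrib]
  ring

lemma wordSum_negMulLog_succ_sub_eq_log (hP : IsParry S m c ρ P) (hS : IsMarkovShift S m) :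
    wordSum (m + 1) (fun w => Real.negMulLog (P w)) - wordSum m (fun w => Real.negMulLog (P w)) =
      Real.log c := by
  rw [hP.isConsistent.wordSum_negMulLog_succ_sub,
    hP.wordSum_mul_log_sub hS hP.isConsistent fun _ => hP.eq_zero_of_notMem, neg_neg]

end IsParry

/-- The deviation of `Q (w ++ [b])` from the value it would have if the letter `b` followed `w` with
the transition probability of `P`, as a linear form in `Q`. -/
noncomputable def defect (P : List (Fin K) → ℝ) (w : List (Fin K)) (b : Fin K) :
    (List (Fin K) → ℝ) →ₗ[ℝ] ℝ :=
  LinearMap.proj (w ++ [b]) - (P (w ++ [b]) / P w) • LinearMap.proj w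

lemma defect_apply (P Q : List (Fin K) → ℝ) (w : List (Fin K)) (b : Fin K) :
    defect P w b Q = Q (w ++ [b]) - P (w ++ [b]) / P w * Q w := rfl

namespace IsParry

lemma defect_self (hP : IsParry S m c ρ P) {w : List (Fin K)} (hm : m ≤ w.length) (b : Fin K) :
    defect P w b P = 0 := by
  rcases eq_or_ne (P w) 0 with h0 | h0
  · have := (hP.isConsistent.concat_le hm b).antisymm (h0 ▸ hP.isConsistent.nonneg _)
    rw [defect_apply, this, h0, mul_zero, sub_zero]
  · rw [defect_apply, div_mul_cancel₀ _ h0, sub_self]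

lemma defect_add_sq_le (hP : IsParry S m c ρ P) (hQ : IsConsistent m Q)
    (hQS : ∀ w, m ≤ w.length → w ∉ S → Q w = 0) {w : List (Fin K)} (hm : m ≤ w.length)
    (hw : w ∈ S) (b : Fin K) :
    defect P w b Q + defect P w b Q ^ 2 / 4 ≤ Q (w ++ [b]) * (Real.log (Q (w ++ [b])) -
      Real.log (Q w) - (Real.log (P (w ++ [b])) - Real.log (P w))) := by
  have hm' : m ≤ (w ++ [b]).length := hm.trans (by simp)
  have hPw := (hP.pos_iff w hm).2 hw
  have hratio : P (w ++ [b]) / P w * Q w ≤ 1 :=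
    mul_le_one₀ ((div_le_one hPw).2 (hP.isConsistent.concat_le hm b)) (hQ.nonneg w) (hQ.le_one hm)
  have hratio0 : 0 ≤ P (w ++ [b]) / P w * Q w :=
    mul_nonneg (div_nonneg (hP.isConsistent.nonneg _) hPw.le) (hQ.nonneg w)
  rw [defect_apply]
  rcases (hQ.nonneg (w ++ [b])).eq_or_lt with h0 | hQb
  · rw [← h0]
    nlinarith
  · have hQw := hQb.trans_le (hQ.concat_le hm b)
    have hPb := (hP.pos_iff _ hm').2 (not_imp_comm.1 (hQS _ hm') hQb.ne')
    have hpos : 0 < P (w ++ [b]) / P w * Q w := mul_pos (div_pos hPb hPw) hQw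
    refine (sub_add_sq_le_mul_log_sub hQb.le (hQ.le_one hm') hratio0 hratio
      fun h => absurd h hpos.ne').trans_eq ?_
    rw [Real.log_mul (div_pos hPb hPw).ne' hQw.ne', Real.log_div hPb.ne' hPw.ne']
    ring

lemma sum_defect (hP : IsParry S m c ρ P) (hQ : IsConsistent m Q) {w : List (Fin K)}
    (hm : m ≤ w.length) (hw : w ∈ S) : ∑ b, defect P w b Q = 0 := by
  simp only [defect_apply, Finset.sum_sub_distrib, ← Finset.sum_mul, ← Finset.sum_div,
    hQ.sum_concat w hm, hP.isConsistent.sum_concat w hm]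
  rw [div_self ((hP.pos_iff w hm).2 hw).ne', one_mul, sub_self]

/-- A form of Pinsker's inequality. -/
lemma wordSum_defect_sq_le (hP : IsParry S m c ρ P) (hS : IsMarkovShift S m)
    (hQ : IsConsistent m Q) (hQS : ∀ w, m ≤ w.length → w ∉ S → Q w = 0) :
    wordSum m (fun w => ∑ b, defect P w b Q ^ 2) ≤
      4 * (Real.log c - (wordSum (m + 1) (fun w => Real.negMulLog (Q w)) -
        wordSum m fun w => Real.negMulLog (Q w))) := by
  rw [hP.log_sub_eq_wordSum hS hQ hQS, ← wordSum_const_mul]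
  refine Finset.sum_le_sum fun z _ => ?_
  have hm : m ≤ (List.ofFn z).length := List.length_ofFn.ge
  generalize List.ofFn z = w at hm
  by_cases hw : w ∈ S
  · have hle := Finset.sum_le_sum fun b (_ : b ∈ Finset.univ) => hP.defect_add_sq_le hQ hQS hm hw b
    rw [Finset.sum_add_distrib, hP.sum_defect hQ hm hw, zero_add, ← Finset.sum_div] at hle
    linarith
  · have hzero (b : Fin K) : Q (w ++ [b]) = 0 :=
      hQS _ (hm.trans (by simp)) (mt hS.mem_of_concat hw)
    simp [defect_apply, hzero, hQS w hm hw]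

end IsParry

lemma IsMarkovShift.forall_of_forall_take_cons (hS : IsMarkovShift S m) {p : List (Fin K) → Prop}
    (hp : ∀ a v, v.length = m → a :: v ∈ S → p v → p ((a :: v).take m)) {u : List (Fin K)}
    (hu : u ∈ S) (hum : u.length = m) (hpu : p u) {v : List (Fin K)} (hv : v ∈ S)
    (hvm : v.length = m) : p v := by
  obtain ⟨y, hy⟩ := hS.connect v hv u hu
  have htake (x : List (Fin K)) (hx : x ++ u ∈ S) : p ((x ++ u).take m) := by
    induction x with
    | nil => rwa [List.nil_append, List.take_of_length_le hum.le]
    | cons a x ih =>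
      have := hp a ((x ++ u).take m) (List.length_take_of_le (by simp [hum]))
        (hS.take_mem hx (m + 1)) (ih (hS.mem_of_cons hx))
      rwa [← List.take_succ_cons, List.take_take, min_eq_left m.le_succ] at this
  have := htake (v ++ y) hy
  rwa [List.append_assoc, List.take_left' hvm] at this

namespace IsParry

/-- The minimum principle for the time-reversed chain. -/
lemma exists_forall_eq_of_average (hP : IsParry S m c ρ P) (hS : IsMarkovShift S m)
    {F : List (Fin K) → ℝ} (hF : ∀ v ∈ S, v.length = m →
      P v * F v = ∑ a, P (a :: v) * F ((a :: v).take m)) :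
    ∃ M, ∀ v ∈ S, v.length = m → F v = M := by
  have := hS.nonempty_state
  obtain ⟨⟨u, hu, hum⟩, hmin⟩ := Finite.exists_min fun v : State S m => F v
  have hle {v : List (Fin K)} (hv : v ∈ S) (hvm : v.length = m) : F u ≤ F v := hmin ⟨v, hv, hvm⟩
  refine ⟨F u, fun v hv hvm => hS.forall_of_forall_take_cons (p := fun v => F v = F u)
    (fun a v hvm hav hv => ?_) hu hum rfl hv hvm⟩
  have hsum : ∑ a, P (a :: v) * (F ((a :: v).take m) - F u) = 0 := by
    simp only [mul_sub, Finset.sum_sub_distrib, ← Finset.sum_mul,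
      ← hF v (hS.mem_of_cons hav) hvm, hP.isConsistent.sum_cons v hvm.ge, hv, sub_self]
  have hnonneg (a : Fin K) : 0 ≤ P (a :: v) * (F ((a :: v).take m) - F u) := by
    by_cases ha : a :: v ∈ S
    · exact mul_nonneg (hP.isConsistent.nonneg _)
        (sub_nonneg.2 (hle (hS.take_mem ha m) (List.length_take_of_le (by simp [hvm]))))
    · rw [hP.eq_zero_of_notMem (by simp [hvm]) ha, zero_mul]
  have hzero := (Finset.sum_eq_zero_iff_of_nonneg fun a _ => hnonneg a).1 hsum a (Finset.mem_univ a)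
  exact sub_eq_zero.1 <|
    (mul_eq_zero.1 hzero).resolve_left ((hP.pos_iff (a :: v) (by simp [hvm])).2 hav).ne'

end IsParry

/-- A linear space containing the differences of consistent families; only the linear equations
on words of length `m` are imposed. -/
def consistentTangent (α : Type*) [Fintype α] (m : ℕ) : Submodule ℝ (List α → ℝ) where
  carrier := {G | (∀ w, w.length = m → ∑ b, G (w ++ [b]) = G w) ∧
    (∀ w, w.length = m → ∑ a, G (a :: w) = G w) ∧ wordSum m G = 0}
  add_mem' := fun ⟨h₁, h₂, h₃⟩ ⟨h₁', h₂', h₃'⟩ => by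
    refine ⟨fun w hw => ?_, fun w hw => ?_, ?_⟩
    · simp only [Pi.add_apply, Finset.sum_add_distrib, h₁ w hw, h₁' w hw]
    · simp only [Pi.add_apply, Finset.sum_add_distrib, h₂ w hw, h₂' w hw]
    · rw [wordSum] at h₃ h₃'
      simp only [wordSum, Pi.add_apply, Finset.sum_add_distrib, h₃, h₃', add_zero]
  zero_mem' := by simp [wordSum]
  smul_mem' := fun c _ ⟨h₁, h₂, h₃⟩ => by
    refine ⟨fun w hw => ?_, fun w hw => ?_, ?_⟩
    · simp only [Pi.smul_apply, ← Finset.smul_sum, h₁ w hw]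
    · simp only [Pi.smul_apply, ← Finset.smul_sum, h₂ w hw]
    · exact (wordSum_const_mul m c _).trans (by rw [h₃, mul_zero])

lemma IsConsistent.sub_mem_consistentTangent {α : Type*} [Fintype α] {P Q : List α → ℝ}
    (hQ : IsConsistent m Q) (hP : IsConsistent m P) : Q - P ∈ consistentTangent α m := by
  refine ⟨fun w hw => ?_, fun w hw => ?_, ?_⟩
  · simp only [Pi.sub_apply, Finset.sum_sub_distrib, hQ.sum_concat w hw.ge, hP.sum_concat w hw.ge]
  · simp only [Pi.sub_apply, Finset.sum_sub_distrib, hQ.sum_cons w hw.ge, hP.sum_cons w hw.ge]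
  · have hQ1 := hQ.wordSum_eq_one
    have hP1 := hP.wordSum_eq_one
    rw [wordSum] at hQ1 hP1
    simp only [wordSum, Pi.sub_apply, Finset.sum_sub_distrib, hQ1, hP1, sub_self]

lemma IsParry.eq_zero_of_defect_eq_zero (hP : IsParry S m c ρ P) (hS : IsMarkovShift S m)
    {G : List (Fin K) → ℝ} (hG : G ∈ consistentTangent (Fin K) m)
    (h : ∀ w b, w.length = m → defect P w b G = 0) {w : List (Fin K)} (hw : w.length = m + 1) :
    G w = 0 := by
  obtain ⟨hconcat, hcons, hmass⟩ := hG
  have heq (w : List (Fin K)) (b : Fin K) (hw : w.length = m) :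
      G (w ++ [b]) = P (w ++ [b]) / P w * G w := sub_eq_zero.1 (h w b hw)
  have htake (v : List (Fin K)) (hv : v.length = m + 1) :
      G v = P v * (G (v.take m) / P (v.take m)) := by
    obtain ⟨u, b, rfl⟩ :=
      (List.eq_nil_or_concat' v).resolve_left (List.ne_nil_of_length_eq_add_one hv)
    have hu : u.length = m := by simpa using hv
    rw [List.take_left' hu, heq u b hu]
    ring
  obtain ⟨M, hM⟩ := hP.exists_forall_eq_of_average hS (F := fun w => G w / P w)
    fun v hv hvm => by
      rw [mul_div_cancel₀ _ ((hP.pos_iff v hvm.ge).2 hv).ne', ← hcons v hvm]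
      exact Finset.sum_congr rfl fun a _ => htake _ (by simp [hvm])
  have hGM (v : List (Fin K)) (hv : v.length = m) : G v = M * P v := by
    by_cases hvS : v ∈ S
    · exact (div_eq_iff ((hP.pos_iff v hv.ge).2 hvS).ne').1 (hM v hvS hv)
    · have hPv := hP.eq_zero_of_notMem hv.ge hvS
      rw [hPv, mul_zero, ← hconcat v hv]
      exact Finset.sum_eq_zero fun b _ => by rw [heq v b hv, hPv, div_zero, zero_mul]
  have hM0 : M = 0 := by
    rwa [wordSum_congr hGM, wordSum_const_mul, hP.isConsistent.wordSum_eq_one, mul_one] at hmass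
  rw [htake w hw, hGM _ (List.length_take_of_le (by omega)), hM0, zero_mul, zero_div, mul_zero]

lemma exists_sq_le_mul_sum_sq {ι E : Type*} [Fintype ι] [AddCommGroup E] [Module ℝ E]
    {L : ι → E →ₗ[ℝ] ℝ} {f : E →ₗ[ℝ] ℝ} (h : ⨅ i, (L i).ker ≤ f.ker) :
    ∃ C, ∀ x, f x ^ 2 ≤ C * ∑ i, L i x ^ 2 := by
  obtain ⟨a, rfl⟩ := (Submodule.mem_span_range_iff_exists_fun ℝ).1 (mem_span_of_iInf_ker_le_ker h)
  refine ⟨∑ i, a i ^ 2, fun x => ?_⟩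
  simpa using Finset.sum_mul_sq_le_sq_mul_sq Finset.univ a fun i => L i x

namespace IsParry

lemma exists_sq_sub_le (hP : IsParry S m c ρ P) (hS : IsMarkovShift S m) {w : List (Fin K)}
    (hw : w.length = m + 1) : ∃ C, ∀ Q, IsConsistent m Q →
      (Q w - P w) ^ 2 ≤ C * wordSum m fun v => ∑ b, defect P v b Q ^ 2 := by
  let T := consistentTangent (Fin K) m
  let L (p : (Fin m → Fin K) × Fin K) : T →ₗ[ℝ] ℝ := defect P (List.ofFn p.1) p.2 ∘ₗ T.subtype
  have hker : ⨅ p, (L p).ker ≤ (LinearMap.proj w ∘ₗ T.subtype : T →ₗ[ℝ] ℝ).ker := by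
    refine fun G hG => hP.eq_zero_of_defect_eq_zero hS G.2 (fun v b hv => ?_) hw
    obtain ⟨z, rfl⟩ := exists_ofFn_eq hv
    exact (Submodule.mem_iInf _).1 hG (z, b)
  obtain ⟨C, hC⟩ := exists_sq_le_mul_sum_sq hker
  refine ⟨C, fun Q hQ => (hC ⟨Q - P, hQ.sub_mem_consistentTangent hP.isConsistent⟩).trans_eq ?_⟩
  rw [Fintype.sum_prod_type, wordSum]
  refine congrArg (C * ·) (Finset.sum_congr rfl fun z _ => Finset.sum_congr rfl fun b _ => ?_)
  have hself : defect P (List.ofFn z) b P = 0 := hP.defect_self List.length_ofFn.ge b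
  change defect P (List.ofFn z) b (Q - P) ^ 2 = _
  rw [map_sub, hself, sub_zero]

lemma exists_wordSum_abs_sub_sq_le (hP : IsParry S m c ρ P) (hS : IsMarkovShift S m) :
    ∃ C, 0 < C ∧ ∀ Q, IsConsistent m Q → wordSum (m + 1) (fun w => |Q w - P w|) ^ 2 ≤
      C * wordSum m fun w => ∑ b, defect P w b Q ^ 2 := by
  choose C hC using fun z : Fin (m + 1) → Fin K =>
    hP.exists_sq_sub_le hS (List.length_ofFn (f := z))
  set A : ℝ := Fintype.card (Fin (m + 1) → Fin K) * ∑ z, C z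
  refine ⟨max A 1, by positivity, fun Q hQ => ?_⟩
  have hnonneg : 0 ≤ wordSum m fun w => ∑ b, defect P w b Q ^ 2 :=
    Finset.sum_nonneg fun _ _ => Finset.sum_nonneg fun _ _ => sq_nonneg _
  calc wordSum (m + 1) (fun w => |Q w - P w|) ^ 2
      ≤ Fintype.card (Fin (m + 1) → Fin K) * ∑ z : Fin (m + 1) → Fin K,
          |Q (List.ofFn z) - P (List.ofFn z)| ^ 2 := sq_sum_le_card_mul_sum_sq
    _ ≤ Fintype.card (Fin (m + 1) → Fin K) * ∑ z, C z * wordSum m fun w =>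
          ∑ b, defect P w b Q ^ 2 := by
        gcongr with z
        exact (sq_abs _).trans_le (hC z Q hQ)
    _ = A * wordSum m fun w => ∑ b, defect P w b Q ^ 2 := by rw [← Finset.sum_mul, mul_assoc]
    _ ≤ max A 1 * wordSum m fun w => ∑ b, defect P w b Q ^ 2 := by
        gcongr
        exact le_max_left A 1

lemma exists_increment_le (hP : IsParry S m c ρ P) (hS : IsMarkovShift S m) :
    ∃ κ, 0 < κ ∧ ∀ ν : Measure (ℤ → Fin K), IsStationaryLaw ν → allowedWords ν ⊆ S →
      increment (blockEntropy ν) (past m) ≤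
        Real.log c - κ * wordSum (m + 1) (fun w => |wordProb ν w - P w|) ^ 2 := by
  obtain ⟨C, hC, hle⟩ := hP.exists_wordSum_abs_sub_sq_le hS
  refine ⟨(4 * C)⁻¹, by positivity, fun ν hν hνS => ?_⟩
  have hdist := hle _ (hν.isConsistent m)
  have hdefect := hP.wordSum_defect_sq_le hS (hν.isConsistent m)
    fun w _ hw => hν.wordProb_eq_zero_of_notMem (mt (@hνS w) hw)
  rw [← hν.increment_past] at hdefect
  have := hdist.trans (mul_le_mul_of_nonneg_left hdefect hC.le)
  rw [← mul_assoc, mul_comm C, ← inv_mul_le_iff₀ (by positivity)] at this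
  linarith

end IsParry

end EntropyGap

namespace IsStationaryLaw

variable {K : ℕ} {μ : Measure (ℤ → Fin K)}

lemma exists_abs_blockEntropy_sub_le (hμ : IsStationaryLaw μ) {i : ℤ} {n : ℕ} {D : Finset ℤ}
    (hD : D ⊆ Finset.Ico i (i + n)) :
    ∃ L, 0 ≤ L ∧ ∀ ν : Measure (ℤ → Fin K), IsStationaryLaw ν →
      allowedWords ν ⊆ allowedWords μ → |blockEntropy ν D - blockEntropy μ D| ≤
        L * wordSum n (fun w => |wordProb ν w - wordProb μ w|) := by
  have := hμ.isProbabilityMeasure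
  obtain ⟨g, hg⟩ := exists_restrict_eq_comp_window (K := K) hD
  have restrict_eq : (fun (x : ℤ → Fin K) (d : D) => x d) = fun x => g (window i n x) :=
    funext hg
  obtain ⟨L, hL, hle⟩ := exists_abs_entropy_comp_sub_le μ (continuous_window i n).measurable g
  refine ⟨L, hL, fun ν hν hνμ => ?_⟩
  have hle := hle ν hν.isProbabilityMeasure
  simp only [window_preimage_singleton, hν.measureReal_wordEvent, hμ.measureReal_wordEvent] at hle
  rw [blockEntropy, blockEntropy, restrict_eq]
  refine hle fun z hz => hν.wordProb_eq_zero_of_notMem fun hmem => ?_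
  exact (hμ.mem_allowedWords.1 (hνμ hmem)).ne' hz

lemma exists_abs_increment_sub_le (hμ : IsStationaryLaw μ) (N : ℕ) :
    ∃ L, 0 ≤ L ∧ ∀ D ⊆ past N, ∀ ν : Measure (ℤ → Fin K), IsStationaryLaw ν →
      allowedWords ν ⊆ allowedWords μ →
        |increment (blockEntropy ν) D - increment (blockEntropy μ) D| ≤
          L * wordSum (N + 1) (fun w => |wordProb ν w - wordProb μ w|) := by
  set B := Finset.Ico (-(N : ℤ)) (-(N : ℤ) + (N + 1 : ℕ))
  choose! L hL hle using fun D (hD : D ⊆ B) => hμ.exists_abs_blockEntropy_sub_le hD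
  have hsum : ∀ D ⊆ B, L D ≤ ∑ E ∈ B.powerset, L E := fun D hD =>
    Finset.single_le_sum (fun E hE => hL E (Finset.mem_powerset.1 hE)) (Finset.mem_powerset.2 hD)
  refine ⟨2 * ∑ E ∈ B.powerset, L E, ?_, fun D hD ν hν hνμ => ?_⟩
  · have := (hL ∅ B.empty_subset).trans (hsum ∅ B.empty_subset)
    positivity
  have hDB : D ⊆ B := hD.trans (Finset.Ico_subset_Ico_right (by push_cast; omega))
  have hinsert : insert 0 D ⊆ B := Finset.insert_subset (by simp [B]) hDB
  set δ := wordSum (N + 1) fun w => |wordProb ν w - wordProb μ w|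
  have hδ : 0 ≤ δ := Finset.sum_nonneg fun z _ => abs_nonneg _
  have block (E : Finset ℤ) (hE : E ⊆ B) :
      |blockEntropy ν E - blockEntropy μ E| ≤ (∑ E ∈ B.powerset, L E) * δ :=
    (hle E hE ν hν hνμ).trans (mul_le_mul_of_nonneg_right (hsum E hE) hδ)
  rw [increment, increment, sub_sub_sub_comm]
  refine (abs_sub _ _).trans ?_
  linarith [block _ hinsert, block _ hDB]

lemma exists_abs_erasureSlope_sub_le (hμ : IsStationaryLaw μ) (N : ℕ) :
    ∃ L, ∀ ν : Measure (ℤ → Fin K), IsStationaryLaw ν → allowedWords ν ⊆ allowedWords μ →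
      |erasureSlope (past N) (increment (blockEntropy ν)) -
          erasureSlope (past N) (increment (blockEntropy μ))| ≤
        L * wordSum (N + 1) (fun w => |wordProb ν w - wordProb μ w|) := by
  obtain ⟨L, -, hle⟩ := hμ.exists_abs_increment_sub_le N
  refine ⟨(2 * (past N).card + 1) * L, fun ν hν hνμ => ?_⟩
  rw [mul_assoc]
  exact abs_erasureSlope_sub_le fun D hD => hle D hD ν hν hνμ

lemma entropyRate_le_increment (hμ : IsStationaryLaw μ) (N : ℕ) :
    entropyRate μ ≤ increment (blockEntropy μ) (past N) := by
  rw [hμ.entropyRate_eq_incrementRate, ← erasureAvg_zero (past N) (increment _)]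
  exact hμ.isStationaryEntropy.incrementRate_le le_rfl zero_le_one N

lemma mutualInfoRate_le (hμ : IsStationaryLaw μ) (ε : I) (N : ℕ) :
    mutualInfoRate μ ε ≤ increment (blockEntropy μ) (past N) +
      ε * erasureSlope (past N) (increment (blockEntropy μ)) + 2 * N * (N + 1) * K * ε ^ 2 := by
  have hH := hμ.isStationaryEntropy
  have hrate := mul_le_mul_of_nonneg_left (hH.incrementRate_le ε.2.1 ε.2.2 N)
    (sub_nonneg.2 ε.2.2)
  have hexp := abs_one_sub_mul_erasureAvg_sub_le ε.2.1 ε.2.2 (s := past N)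
    fun D _ => hH.abs_increment_le D
  rw [card_past] at hexp
  rw [hμ.mutualInfoRate_eq]
  linarith [(abs_le.1 hexp).2]

end IsStationaryLaw

lemma IsMarkovOfOrder.mono {K m n : ℕ} {μ : Measure (ℤ → Fin K)} (h : IsMarkovOfOrder m μ)
    (hmn : m ≤ n) : IsMarkovOfOrder n μ := by
  intro t k z hnk hne
  rw [h t k z (hmn.trans hnk) hne, h t n z hmn]
  have hsub : agreeOn (Set.Ico (t - k) t) z ⊆ agreeOn (Set.Ico (t - n) t) z :=
    fun x hx i hi => hx i (Set.Ico_subset_Ico_left (by omega) hi)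
  exact fun h0 => hne (measure_mono_null hsub h0)

namespace IsParry

variable {K m : ℕ} {S : Set (List (Fin K))} {c : ℝ} {ρ P : List (Fin K) → ℝ}
  {μ ν : Measure (ℤ → Fin K)}

lemma entropyRate_le_log (hP : IsParry S m c ρ P) (hS : IsMarkovShift S m)
    (hν : IsStationaryLaw ν) (hνS : allowedWords ν ⊆ S) : entropyRate ν ≤ Real.log c := by
  obtain ⟨κ, hκ, hgap⟩ := hP.exists_increment_le hS
  have : 0 ≤ κ * wordSum (m + 1) (fun w => |wordProb ν w - P w|) ^ 2 := by positivity
  linarith [hgap ν hν hνS, hν.entropyRate_le_increment m]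

lemma wordProb_eq_of_log_le_entropyRate (hP : IsParry S m c ρ P) (hS : IsMarkovShift S m)
    (hν : IsStationaryLaw ν) (hνS : allowedWords ν ⊆ S) (h : Real.log c ≤ entropyRate ν)
    {w : List (Fin K)} (hw : w.length = m + 1) : wordProb ν w = P w := by
  obtain ⟨κ, hκ, hgap⟩ := hP.exists_increment_le hS
  have hzero : κ * wordSum (m + 1) (fun w => |wordProb ν w - P w|) ^ 2 ≤ 0 := by
    linarith [hgap ν hν hνS, hν.entropyRate_le_increment m]
  have hdist := pow_eq_zero_iff two_ne_zero |>.1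
    (le_antisymm (nonpos_of_mul_nonpos_right hzero hκ) (sq_nonneg _))
  have hle := le_wordSum (f := fun w => |wordProb ν w - P w|) (fun _ _ => abs_nonneg _) hw
  rw [hdist] at hle
  exact sub_eq_zero.1 (abs_nonpos_iff.1 hle)

variable (hP : IsParry (allowedWords μ) m c ρ (wordProb μ))
  (hS : IsMarkovShift (allowedWords μ) m) (hμ : IsStationaryLaw μ)

include hP hS hμ

lemma increment_past_eq_log {k : ℕ} (hk : m ≤ k) :
    increment (blockEntropy μ) (past k) = Real.log c := by
  rw [hμ.increment_past, (hP.mono hk).wordSum_negMulLog_succ_sub_eq_log (hS.mono hk)]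

lemma entropyRate_eq_log : entropyRate μ = Real.log c := by
  refine le_antisymm (hP.entropyRate_le_log hS hμ subset_rfl) ?_
  rw [hμ.entropyRate_eq_incrementRate]
  refine hμ.isStationaryEntropy.le_incrementRate (N := m) le_rfl zero_le_one fun k hk => ?_
  rw [erasureAvg_zero, hP.increment_past_eq_log hS hμ hk]

lemma isMaxentropic (hmk : IsMarkovOfOrder m μ) : IsMaxentropic (allowedWords μ) m μ :=
  ⟨hμ, hmk, rfl, fun _ hν hνS =>
    (hP.entropyRate_le_log hS hν hνS).trans_eq (hP.entropyRate_eq_log hS hμ).symm⟩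

lemma eq_of_isMaxentropic (hν : IsMaxentropic (allowedWords μ) m ν) : ν = μ := by
  have := hμ.isProbabilityMeasure
  have := hν.stationary.isProbabilityMeasure
  have hrate := hν.entropyRate_le μ hμ subset_rfl
  rw [hP.entropyRate_eq_log hS hμ] at hrate
  refine measure_ext_of_wordEvent (m + 1) fun i w hw => ?_
  obtain ⟨N, hN⟩ : ∃ N, w.length = N + 1 := ⟨w.length - 1, by omega⟩
  rw [← ofReal_measureReal, ← ofReal_measureReal, hν.stationary.measureReal_wordEvent,
    hμ.measureReal_wordEvent, (hP.mono (by omega)).wordProb_eq_of_log_le_entropyRate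
      (hS.mono (by omega)) hν.stationary hν.allowedWords_eq.subset hrate hN]

lemma erasureSlope_eq_neg_linearCoeff :
    erasureSlope (past (2 * m)) (increment (blockEntropy μ)) = -linearCoeff m μ := by
  have := hμ.isProbabilityMeasure
  rw [hμ.isStationaryEntropy.erasureSlope_of_markov fun k => hP.increment_past_eq_log hS hμ,
    linearCoeff]
  simp only [condEntropyZero_eq_sub]
  rfl

lemma exists_mutualInfoRate_le : ∃ C, ∀ ν : Measure (ℤ → Fin K), IsStationaryLaw ν →
    allowedWords ν ⊆ allowedWords μ → ∀ ε : I,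
      mutualInfoRate ν ε ≤ Real.log c - linearCoeff m μ * ε + C * (ε : ℝ) ^ 2 := by
  obtain ⟨κ, hκ, hgap⟩ :=
    (hP.mono (by omega : m ≤ 2 * m)).exists_increment_le (hS.mono (by omega))
  obtain ⟨L, hlip⟩ := hμ.exists_abs_erasureSlope_sub_le (2 * m)
  refine ⟨2 * (2 * m : ℕ) * ((2 * m : ℕ) + 1) * K + L ^ 2 / (4 * κ), fun ν hν hνμ ε => ?_⟩
  have hrate := hν.mutualInfoRate_le ε (2 * m)
  have hent := hgap ν hν hνμ
  have hslope := mul_le_mul_of_nonneg_left (abs_le.1 (hlip ν hν hνμ)).2 ε.2.1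
  rw [hP.erasureSlope_eq_neg_linearCoeff hS hμ] at hslope
  set δ := wordSum (2 * m + 1) fun w => |wordProb ν w - wordProb μ w|
  have hsquare : κ * δ ^ 2 + L ^ 2 / (4 * κ) * (ε : ℝ) ^ 2 - ε * (L * δ) =
      κ * (δ - L * ε / (2 * κ)) ^ 2 := by
    field_simp
    ring
  have : 0 ≤ κ * (δ - L * ε / (2 * κ)) ^ 2 := by positivity
  linarith

lemma le_mutualInfoRate (ε : I) :
    Real.log c - linearCoeff m μ * ε - 2 * (2 * m : ℕ) * ((2 * m : ℕ) + 1) * K * (ε : ℝ) ^ 2 ≤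
      mutualInfoRate μ ε := by
  have hH := hμ.isStationaryEntropy
  have hle {k : ℕ} (hk : 2 * m ≤ k) := hH.le_erasureAvg_of_markov
    (fun k => hP.increment_past_eq_log hS hμ) ε.2.1 ε.2.2 hk
  rw [hP.erasureSlope_eq_neg_linearCoeff hS hμ, mul_neg, ← sub_eq_add_neg,
    mul_comm (ε : ℝ)] at hle
  rw [hμ.mutualInfoRate_eq]
  rcases ε.2.2.eq_or_lt with h | h
  · have := hle le_rfl
    rw [h] at this ⊢
    simpa using this
  · have hpos : 0 < 1 - (ε : ℝ) := sub_pos.2 h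
    rw [← div_le_iff₀' hpos]
    refine hH.le_incrementRate (N := 2 * m) ε.2.1 ε.2.2 fun k hk => ?_
    rw [div_le_iff₀' hpos]
    exact hle hk

lemma capacity_zero : capacity (allowedWords μ) 0 = Real.log c := by
  have := hμ.isProbabilityMeasure
  refine IsGreatest.csSup_eq ⟨⟨μ, hμ, subset_rfl, ?_⟩, ?_⟩
  · rw [mutualInfoRate_zero, hP.entropyRate_eq_log hS hμ]
  · rintro _ ⟨ν, hν, hνμ, rfl⟩
    have := hν.isProbabilityMeasure
    rw [mutualInfoRate_zero]
    exact hP.entropyRate_le_log hS hν hνμ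

lemma isBigO_sSup_sub {T : I → Set ℝ} (hmem : ∀ ε, mutualInfoRate μ ε ∈ T ε)
    (hT : ∀ ε, ∀ r ∈ T ε, ∃ ν : Measure (ℤ → Fin K),
      IsStationaryLaw ν ∧ allowedWords ν ⊆ allowedWords μ ∧ r = mutualInfoRate ν ε) :
    (fun ε : I => sSup (T ε) - (capacity (allowedWords μ) 0 - linearCoeff m μ * (ε : ℝ)))
      =O[⊤] fun ε : I => (ε : ℝ) ^ 2 := by
  rw [hP.capacity_zero hS hμ]
  obtain ⟨C, hC⟩ := hP.exists_mutualInfoRate_le hS hμ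
  set C' : ℝ := 2 * (2 * m : ℕ) * ((2 * m : ℕ) + 1) * K
  refine Asymptotics.IsBigO.of_bound (max C C') (Eventually.of_forall fun ε => ?_)
  have hupper : ∀ r ∈ T ε, r ≤ Real.log c - linearCoeff m μ * ε + C * (ε : ℝ) ^ 2 := by
    intro r hr
    obtain ⟨ν, hν, hνμ, rfl⟩ := hT ε r hr
    exact hC ν hν hνμ ε
  have hlower := (hP.le_mutualInfoRate hS hμ ε).trans (le_csSup ⟨_, hupper⟩ (hmem ε))
  have hle := csSup_le ⟨_, hmem ε⟩ hupper
  have hmax := mul_le_mul_of_nonneg_right (le_max_left C C') (sq_nonneg (ε : ℝ))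
  have hmax' := mul_le_mul_of_nonneg_right (le_max_right C C') (sq_nonneg (ε : ℝ))
  rw [Real.norm_eq_abs, Real.norm_eq_abs, abs_of_nonneg (sq_nonneg (ε : ℝ)), abs_le]
  constructor <;> linarith

end IsParry

end ErasureChannel

theorem mainTheorem1 {K : ℕ} (S : Set (List (Fin K))) (hS : IsFiniteType S)
    (hirr : IsIrreducibleConstraint S) (hne : ∃ w ∈ S, w ≠ []) :
    (∃! μ : Measure (ℤ → Fin K), IsMaxentropic S (topologicalOrder S) μ) ∧
    ∀ μ : Measure (ℤ → Fin K), IsMaxentropic S (topologicalOrder S) μ →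
      ((fun ε : I => capacity S ε -
          (capacity S 0 - linearCoeff (topologicalOrder S) μ * (ε : ℝ)))
        =O[𝓝 (0 : I)] fun ε : I => (ε : ℝ) ^ 2) ∧
      ∀ n : ℕ, topologicalOrder S ≤ n →
        (fun ε : I => markovCapacity n S ε -
          (capacity S 0 - linearCoeff (topologicalOrder S) μ * (ε : ℝ)))
        =O[𝓝 (0 : I)] fun ε : I => (ε : ℝ) ^ 2 := by
  have hM := isMarkovShift_topologicalOrder hS hirr hne
  generalize topologicalOrder S = m at hM ⊢
  obtain ⟨c, ρ, P, hP⟩ := hM.exists_isParry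
  obtain ⟨μ₀, hst, hmk, rfl, hμ₀⟩ := hP.exists_law hM
  refine ⟨⟨μ₀, hμ₀.isMaxentropic hM hst hmk, fun ν hν => hμ₀.eq_of_isMaxentropic hM hst hν⟩,
    fun μ hμ => ?_⟩
  obtain rfl := hμ₀.eq_of_isMaxentropic hM hst hμ
  refine ⟨.mono (hμ₀.isBigO_sSup_sub hM hst (fun ε => ⟨μ, hst, subset_rfl, rfl⟩)
    fun ε r hr => hr) le_top, fun n hn => .mono (hμ₀.isBigO_sSup_sub hM hst
      (fun ε => ⟨μ, hst, hmk.mono hn, subset_rfl, rfl⟩) ?_) le_top⟩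
  rintro ε r ⟨ν, hν, -, hνμ, rfl⟩
  exact ⟨ν, hν, hνμ, rfl⟩
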